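/- Let $(X,d)$ be a complete separable metric space and let $d_L:X\times X\to[0,+\infty]$ be a Borel function which is an extended distance on $X$ (the value $+\infty$ is allowed). A geodesic is a map $\gamma:I\to X$, with $I\subset\mathbb R$ any interval, such that $d_L(\gamma(s),\gamma(t))=|s-t|$ for all $s,t\in I$. Assume that: (i) any two points $x,y$ with $d_L(x,y)<+\infty$ are the end points of a geodesic defined on $[0,d_L(x,y)]$; (ii) $(X,d_L)$ is non-branching: for all $r\in[0,+\infty)$ and $x,y$ with $d_L(x,y)=r/2$ there is at most one $z$ with $d_L(x,z)=r$ and $d_L(y,z)=r/2$; (iii) geodesics are $d$-continuous, and for every geodesic $\gamma$ and every point $x$ of $\gamma$ there is $r>0$ such that $\gamma^{-1}(\{y:d(x,y)\le r\})$ is compact in $\mathbb R$. Let $\mu,\nu$ be Borel probability measures on $X$, and let $\pi$ be a Borel probability measure on $X\times X$ with marginals $\mu,\nu$ and $\int d_L\,d\pi<+\infty$. Assume that $\pi$ is $d_L$-cyclically monotone, and fix a Borel set $\Gamma\subset\{d_L<+\infty\}$ with $\pi(\Gamma)=1$ which is $d_L$-cyclically monotone: $\sum_{i=0}^n d_L(x_i,y_i)\le\sum_{i=0}^n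 d_L(x_{i+1},y_i)$ (with $x_{n+1}=x_0$) whenever $(x_0,y_0),\dots,(x_n,y_n)\in\Gamma$. Let $\Gamma'$ be the set of the pairs $(w_0,z_I)$ such that $(w_0,z_0),\dots,(w_I,z_I)\in\Gamma$ and $\sum_{i=0}^I d_L(w_{i+1},z_i)=\sum_{i=0}^I d_L(w_i,z_i)$, $w_{I+1}=w_0$, for some $I\ge0$. Let $$G=\{(x,y):\exists (w,z)\in\Gamma',\ d_L(w,x)+d_L(x,y)+d_L(y,z)=d_L(w,z)\}$$ be the set of oriented transport rays. Let $\mathcal T$ (respectively $\mathcal T_e$) be the set of the points $x$ such that $(y,x)\in G$ for some $y\ne x$ and (respectively or) $(x,y)\in G$ for some $y\neq x$. For $y\in\mathcal T$ let $g(y,t)$ be the point $x$ with signed coordinate $t$ on the ray through $y$: $(y,x)\in G$ and $d_L(y,x)=t$ if $t\ge0$, $(x,y)\in G$ and $d_L(y,x)=-t$ if $t<0$ (if there is such a point). For $A\subset\mathcal T_e$ let $A_t=g(g^{-1}(A)+(0,t))$ be the translation of $A$ by $t$ along the rays. Assume that for every Borel set $A\subset\mathcal T_e$ with $\mu(A)>0$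 the set $\{t>0:\mu(A_t)>0\}$ is uncountable. Then there is a Borel map $T:X\to X$ with $T_\sharp\mu=\nu$ and $$\int d_L(x,T(x))\,\mu(dx)=\int d_L\,d\pi ,$$ which is moreover monotone along the rays: there is a $\mu$-negligible set $N$ such that $T(x)=x$ or $(x,T(x))\in G$ for every $x\notin N$, and $(T(x),T(x'))\in G$ whenever $x,x'\notin N$ and $(x,x')\in G$. -/

import Mathlib

open MeasureTheory Set
open scoped ENNReal NNReal

namespace GeodesicMonge

/-- `γ` restricted to the interval `I ⊆ ℝ` (bounded or not, with or without its end points) is a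
minimizing geodesic of the extended distance `dL`, parametrized by arc length. -/
def IsGeodesicOn {X : Type*} (dL : X → X → ℝ≥0∞) (γ : ℝ → X) (I : Set ℝ) : Prop :=
  I.OrdConnected ∧ ∀ s ∈ I, ∀ t ∈ I, dL (γ s) (γ t) = ENNReal.ofReal |s - t|

/-- The standing assumptions on `dL` on the Polish space `(X, d)`: it is a Borel distance with
values in `[0, +∞]`, for which `X` is a non-branching geodesic space whose geodesics are
`d`-continuous and locally compact in `(X, d)`. -/
structure IsNonbranchingGeodesicDist {X : Type*} [MetricSpace X] [MeasurableSpace X]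
    (dL : X → X → ℝ≥0∞) : Prop where
  measurable : Measurable (Function.uncurry dL)
  eq_zero_iff : ∀ x y, dL x y = 0 ↔ x = y
  symm : ∀ x y, dL x y = dL y x
  triangle : ∀ x y z, dL x z ≤ dL x y + dL y z
  /-- Points at finite distance are joined by a minimizing geodesic. -/
  geodesic : ∀ x y, dL x y ≠ ∞ → ∃ γ : ℝ → X,
    IsGeodesicOn dL γ (Icc 0 (dL x y).toReal) ∧ γ 0 = x ∧ γ (dL x y).toReal = y
  /-- Geodesics do not branch: from `x` one can go beyond `y`, by the length `dL x y = r / 2`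
  and along a geodesic through `y`, to at most one point. -/
  nonbranching : ∀ (r : ℝ≥0) (x y : X), dL x y = (r / 2 : ℝ≥0) →
    ({z | dL x z = r} ∩ {z | dL y z = (r / 2 : ℝ≥0)}).Subsingleton
  continuousOn : ∀ (γ : ℝ → X) (I : Set ℝ), IsGeodesicOn dL γ I → ContinuousOn γ I
  /-- Geodesics are locally compact in `(X, d)`. -/
  locallyCompact : ∀ (γ : ℝ → X) (I : Set ℝ), IsGeodesicOn dL γ I →
    ∀ x ∈ γ '' I, ∃ r > 0, IsCompact (I ∩ γ ⁻¹' Metric.closedBall x r)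

variable {X : Type*}

/-- `c`-cyclical monotonicity of `Γ`; the index `i + 1` in `Fin (n + 1)` is cyclic. -/
def CyclicallyMonotone (c : X → X → ℝ≥0∞) (Γ : Set (X × X)) : Prop :=
  ∀ (n : ℕ) (x y : Fin (n + 1) → X), (∀ i, (x i, y i) ∈ Γ) →
    ∑ i, c (x i) (y i) ≤ ∑ i, c (x (i + 1)) (y i)

/-- `Π(μ, ν)`: the transference plans from `μ` to `ν`. -/
def IsTransferencePlan [MeasurableSpace X] (μ ν : Measure X) (π : Measure (X × X)) : Prop :=
  IsProbabilityMeasure π ∧ π.map Prod.fst = μ ∧ π.map Prod.snd = ν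

/-- `Γ'`: the pairs (first initial point, last final point) of the cycles of points of `Γ` with
zero total cost; the index `i + 1` in `Fin (I + 1)` is cyclic. -/
def cycleSet (dL : X → X → ℝ≥0∞) (Γ : Set (X × X)) : Set (X × X) :=
  {p | ∃ (I : ℕ) (w z : Fin (I + 1) → X), (∀ i, (w i, z i) ∈ Γ) ∧
    w 0 = p.1 ∧ z (Fin.last I) = p.2 ∧
    ∑ i, dL (w (i + 1)) (z i) = ∑ i, dL (w i) (z i)}

/-- `G`: the set of oriented transport rays. -/
def orientedRays (dL : X → X → ℝ≥0∞) (Γ : Set (X × X)) : Set (X × X) :=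
  {p | ∃ w z, (w, z) ∈ cycleSet dL Γ ∧ dL w p.1 + dL p.1 p.2 + dL p.2 z = dL w z}

/-- `𝒯`: the transport set without end points. -/
def transportSet (dL : X → X → ℝ≥0∞) (Γ : Set (X × X)) : Set X :=
  {x | (∃ y, y ≠ x ∧ (y, x) ∈ orientedRays dL Γ) ∧ ∃ y, y ≠ x ∧ (x, y) ∈ orientedRays dL Γ}

/-- `𝒯ₑ`: the transport set with end points. -/
def transportSetE (dL : X → X → ℝ≥0∞) (Γ : Set (X × X)) : Set X :=
  {x | (∃ y, y ≠ x ∧ (y, x) ∈ orientedRays dL Γ) ∨ ∃ y, y ≠ x ∧ (x, y) ∈ orientedRays dL Γ}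

/-- The graph of the ray map `g`: `(y, t, x)` belongs to it if `x` is the point with signed
`dL`-arc length coordinate `t` on the oriented ray through `y ∈ 𝒯`, with origin at `y`. -/
def rayMap (dL : X → X → ℝ≥0∞) (Γ : Set (X × X)) : Set (X × ℝ × X) :=
  {p | p.1 ∈ transportSet dL Γ ∧
    ((0 ≤ p.2.1 ∧ (p.1, p.2.2) ∈ orientedRays dL Γ ∧
        dL p.1 p.2.2 = ENNReal.ofReal p.2.1) ∨
      (p.2.1 < 0 ∧ (p.2.2, p.1) ∈ orientedRays dL Γ ∧
        dL p.1 p.2.2 = ENNReal.ofReal (-p.2.1)))}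

/-- The evolution `A_t = g (g⁻¹ (A) + (0, t))`, the translation of `A` by `t` along the rays.
All base points `y ∈ 𝒯` are used, rather than one per ray: changing the base point on a ray only
shifts the coordinate of its points by a constant, so the set `A_t` is the same. -/
def evolution (dL : X → X → ℝ≥0∞) (Γ : Set (X × X)) (A : Set X) (t : ℝ) : Set X :=
  {z | ∃ y s x, x ∈ A ∧ (y, s, x) ∈ rayMap dL Γ ∧ (y, s + t, z) ∈ rayMap dL Γ}

/-- The non-degeneracy assumption: if a Borel set `A` of the transport set has positive measure,
then so do its translates `A_t` for uncountably many `t > 0`. -/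
def NonDegenerate [MeasurableSpace X] (dL : X → X → ℝ≥0∞) (Γ : Set (X × X)) (μ : Measure X) :
    Prop :=
  ∀ A : Set X, MeasurableSet A → A ⊆ transportSetE dL Γ → 0 < μ A →
    ¬ {t : ℝ | 0 < t ∧ 0 < μ (evolution dL Γ A t)}.Countable

end GeodesicMonge

/-! Cyclical monotonicity makes `orientedRays` transitive and antisymmetric, with `dL` additive
along it (`orientedRays_trans`). Non-branching makes the points comparable with a given interior
point a chain (`RaySetting.comparable`), so that each ray through `transportSet` is an oriented
geodesic. The plan is carried by `Γ ⊆ orientedRays`: it moves mass forward along the rays and leaves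
in place what starts outside `transportSetE`.

Non-degeneracy forbids atoms on the rays. A set that meets every ray in one point at most has
translates that are disjoint up to end points; only countably many of them can have positive
measure, so the set is negligible (`measure_antichain`). The end points are negligible as well, and
the conditional laws of `μ` on the rays are diffuse. On each ray the initial law can then be sent to
the final one by the monotone rearrangement. The cost is preserved because on a line all forward
plans with the same marginals have the same cost, the integral of the difference of the distribution
functions (`lintegral_arcCost`); the rearrangement is itself forward, since the plan orders these
functions.

Measurability needs no cross-section of the rays. A ray is recognized by the basic open sets that
its interior meets (`label`), and a point on it by a weighted count of the basic open sets that it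
has left behind (`height`). Local compactness of geodesics makes these data separate the rays and
the points of each ray. They are built from analytic sets, hence universally measurable, and the
plan can be disintegrated in these coordinates (`exists_fiber_rearrangement`). The height is not arc
length, but it is increasing along the ray, and a monotone change of variable recovers the cost
(`exists_arcCost_eq`). -/

namespace GeodesicMonge

/-! ### Chains in a cyclically monotone set -/

/-- `ChainCost c Γ w z a b`: there are `(w₀, z₀), …, (w_I, z_I)` in `Γ` with `w₀ = w` and `z_I = z`,
for which `∑ c(wᵢ, zᵢ) = a` and `∑ c(wᵢ₊₁, zᵢ) = b`, the last sum being taken for `i < I`. -/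
inductive ChainCost {X : Type*} (c : X → X → ℝ≥0∞) (Γ : Set (X × X)) :
    X → X → ℝ≥0∞ → ℝ≥0∞ → Prop
  | single {w z : X} : (w, z) ∈ Γ → ChainCost c Γ w z (c w z) 0
  | snoc {w z w' z' : X} {a b : ℝ≥0∞} : ChainCost c Γ w z a b → (w', z') ∈ Γ →
      ChainCost c Γ w z' (a + c w' z') (b + c w' z)

theorem sum_cyclic {X : Type*} (c : X → X → ℝ≥0∞) {I : ℕ} (u v : Fin (I + 1) → X) :
    ∑ i, c (u (i + 1)) (v i) =
      ∑ i : Fin I, c (u i.succ) (v i.castSucc) + c (u 0) (v (Fin.last I)) := by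
  rw [Fin.sum_univ_castSucc]
  simp [Fin.coeSucc_eq_succ]

theorem chainCost_of_fin {X : Type*} {c : X → X → ℝ≥0∞} {Γ : Set (X × X)} :
    ∀ {I : ℕ} (u v : Fin (I + 1) → X), (∀ i, (u i, v i) ∈ Γ) →
      ChainCost c Γ (u 0) (v (Fin.last I)) (∑ i, c (u i) (v i))
        (∑ i : Fin I, c (u i.succ) (v i.castSucc)) := by
  intro I
  induction I with
  | zero =>
    intro u v h
    simpa using ChainCost.single (c := c) (h 0)
  | succ n ih =>
    intro u v h
    have h1 := ih (fun i => u i.castSucc) (fun i => v i.castSucc) (fun i => h _)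
    have h2 := ChainCost.snoc h1 (h (Fin.last (n + 1)))
    rw [Fin.sum_univ_castSucc (n := n + 1),
      Fin.sum_univ_castSucc (n := n) (fun i => c (u i.succ) (v i.castSucc))]
    exact h2

theorem ChainCost.exists_fin {X : Type*} {c : X → X → ℝ≥0∞} {Γ : Set (X × X)} {w z : X}
    {a b : ℝ≥0∞} (h : ChainCost c Γ w z a b) :
    ∃ (I : ℕ) (u v : Fin (I + 1) → X), (∀ i, (u i, v i) ∈ Γ) ∧ u 0 = w ∧ v (Fin.last I) = z ∧
      ∑ i, c (u i) (v i) = a ∧ ∑ i : Fin I, c (u i.succ) (v i.castSucc) = b := by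
  induction h with
  | @single z h =>
    exact ⟨0, fun _ => w, fun _ => z, fun _ => h, rfl, rfl, by simp, by simp⟩
  | @snoc z w' z' a b h hΓ ih =>
    obtain ⟨I, u, v, huv, hw, hz, ha, hb⟩ := ih
    refine ⟨I + 1, Fin.snoc (α := fun _ => X) u w', Fin.snoc (α := fun _ => X) v z', ?_, ?_, ?_,
      ?_, ?_⟩
    · intro i
      induction i using Fin.lastCases with
      | last => simpa using hΓ
      | cast i => simpa using huv i
    · rw [← Fin.castSucc_zero, Fin.snoc_castSucc]; exact hw
    · simp
    · rw [Fin.sum_univ_castSucc]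
      simp [ha]
    · rw [Fin.sum_univ_castSucc]
      simp only [← Fin.castSucc_succ, Fin.snoc_castSucc, Fin.succ_last, Fin.snoc_last]
      rw [hb, hz]

/-- The price of concatenation is the link `c w' z`. Closing the long chain by `c w z'` compares two
cycles with the one obtained by exchanging their closing links. -/
theorem ChainCost.append {X : Type*} {c : X → X → ℝ≥0∞} {Γ : Set (X × X)} {w z w' z' : X}
    {a b a' b' : ℝ≥0∞} (h : ChainCost c Γ w z a b) (h' : ChainCost c Γ w' z' a' b') :
    ChainCost c Γ w z' (a + a') (b + b' + c w' z) := by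
  induction h' with
  | single hΓ => simpa using ChainCost.snoc h hΓ
  | snoc h' hΓ ih =>
    have := ChainCost.snoc ih hΓ
    convert this using 1 <;> ring

theorem ChainCost.ne_top {X : Type*} {c : X → X → ℝ≥0∞} {Γ : Set (X × X)}
    (hfin : ∀ p ∈ Γ, c p.1 p.2 ≠ ∞) {w z : X} {a b : ℝ≥0∞} (h : ChainCost c Γ w z a b) :
    a ≠ ∞ := by
  induction h with
  | single hΓ => exact hfin _ hΓ
  | snoc _ hΓ ih => exact ENNReal.add_ne_top.2 ⟨ih, hfin _ hΓ⟩

theorem ChainCost.le {X : Type*} {c : X → X → ℝ≥0∞} {Γ : Set (X × X)}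
    (hmono : CyclicallyMonotone c Γ) {w z : X} {a b : ℝ≥0∞} (h : ChainCost c Γ w z a b) :
    a ≤ b + c w z := by
  obtain ⟨I, u, v, huv, rfl, rfl, rfl, rfl⟩ := h.exists_fin
  rw [← sum_cyclic]
  exact hmono I u v huv

theorem mem_cycleSet_iff {X : Type*} {c : X → X → ℝ≥0∞} {Γ : Set (X × X)} {w z : X} :
    (w, z) ∈ cycleSet c Γ ↔ ∃ a b, ChainCost c Γ w z a b ∧ b + c w z = a := by
  constructor
  · rintro ⟨I, u, v, huv, hw, hz, h⟩
    simp only at hw hz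
    subst hw hz
    exact ⟨_, _, chainCost_of_fin u v huv, by rw [← sum_cyclic, h]⟩
  · rintro ⟨a, b, h, hab⟩
    obtain ⟨I, u, v, huv, rfl, rfl, rfl, rfl⟩ := h.exists_fin
    exact ⟨I, u, v, huv, rfl, rfl, by rw [sum_cyclic, hab]⟩

theorem subset_cycleSet {X : Type*} (c : X → X → ℝ≥0∞) (Γ : Set (X × X)) : Γ ⊆ cycleSet c Γ :=
  fun _ hp => mem_cycleSet_iff.2 ⟨_, _, ChainCost.single hp, zero_add _⟩

theorem cycleSet_ne_top {X : Type*} {c : X → X → ℝ≥0∞} {Γ : Set (X × X)}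
    (hfin : ∀ p ∈ Γ, c p.1 p.2 ≠ ∞) {w z : X} (h : (w, z) ∈ cycleSet c Γ) : c w z ≠ ∞ := by
  obtain ⟨a, b, h, hab⟩ := mem_cycleSet_iff.1 h
  have := h.ne_top hfin
  rw [← hab] at this
  exact (ENNReal.add_ne_top.1 this).2

/-- `Γ'` is monotone along cycles of length two, and closed under those of zero total cost. -/
theorem cycleSet_two_cycle {X : Type*} {c : X → X → ℝ≥0∞} {Γ : Set (X × X)}
    (hfin : ∀ p ∈ Γ, c p.1 p.2 ≠ ∞) (hmono : CyclicallyMonotone c Γ) {w z w' z' : X}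
    (h : (w, z) ∈ cycleSet c Γ) (h' : (w', z') ∈ cycleSet c Γ) :
    c w z + c w' z' ≤ c w' z + c w z' ∧
      (c w' z + c w z' ≤ c w z + c w' z' → (w, z') ∈ cycleSet c Γ) := by
  obtain ⟨a, b, hab, rfl⟩ := mem_cycleSet_iff.1 h
  obtain ⟨a', b', hab', rfl⟩ := mem_cycleSet_iff.1 h'
  have hb : b + b' ≠ ∞ := ENNReal.add_ne_top.2
    ⟨(ENNReal.add_ne_top.1 (hab.ne_top hfin)).1, (ENNReal.add_ne_top.1 (hab'.ne_top hfin)).1⟩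
  have key := (hab.append hab').le hmono
  have key' : c w z + c w' z' ≤ c w' z + c w z' := by
    refine (ENNReal.add_le_add_iff_left hb).1 ?_
    convert key using 1 <;> ring
  refine ⟨key', fun hle => mem_cycleSet_iff.2 ⟨_, _, hab.append hab', ?_⟩⟩
  have := le_antisymm hle key'
  calc b + b' + c w' z + c w z' = b + b' + (c w' z + c w z') := by ring
    _ = b + c w z + (b' + c w' z') := by rw [this]; ring

/-! ### The oriented rays as a partial order -/

section Rays

variable {X : Type*} {c : X → X → ℝ≥0∞} {Γ : Set (X × X)}

theorem subset_orientedRays (hself : ∀ x, c x x = 0) : Γ ⊆ orientedRays c Γ := by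
  rintro ⟨x, y⟩ h
  exact ⟨x, y, subset_cycleSet c Γ h, by simp [hself]⟩

theorem orientedRays_ne_top (hfin : ∀ p ∈ Γ, c p.1 p.2 ≠ ∞) {x y : X}
    (h : (x, y) ∈ orientedRays c Γ) : c x y ≠ ∞ := by
  obtain ⟨w, z, hwz, h⟩ := h
  have := cycleSet_ne_top hfin hwz
  rw [← h] at this
  simp only [ne_eq, ENNReal.add_eq_top, not_or] at this
  exact this.1.2

/-- Points on a shortest path between the points of an oriented pair. -/
theorem orientedRays_of_between (htri : ∀ x y z, c x z ≤ c x y + c y z) {x y u v : X}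
    (h : (x, y) ∈ orientedRays c Γ) (huv : c x u + c u v + c v y = c x y) :
    (u, v) ∈ orientedRays c Γ := by
  obtain ⟨w, z, hwz, h⟩ := h
  refine ⟨w, z, hwz, le_antisymm ?_ ?_⟩
  · simp only at h ⊢
    rw [← h, ← huv]
    calc c w u + c u v + c v z ≤ (c w x + c x u) + c u v + (c v y + c y z) := by
          gcongr <;> apply htri
      _ = _ := by ring
  · calc c w z ≤ c w u + c u z := htri _ _ _
      _ ≤ c w u + (c u v + c v z) := by gcongr; apply htri
      _ = _ := by ring

/-- Let `y` lie on shortest paths from `w` to `v` and from `w'` to `v'`. The crossed pairs cost at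
most the paths `w', y, v` and `w, x, z, v'`, while monotonicity along two-cycles bounds their cost
from below by that of the given pairs. After cancellation this reads `c x y + c y z ≤ c x z`. Hence
all these inequalities are equalities, `(w, v')` belongs to `Γ'`, and `x`, `z` lie in order between
`w` and `v'`. -/
theorem orientedRays_trans (htri : ∀ x y z, c x z ≤ c x y + c y z)
    (hfin : ∀ p ∈ Γ, c p.1 p.2 ≠ ∞) (hmono : CyclicallyMonotone c Γ) {x y z : X}
    (h : (x, y) ∈ orientedRays c Γ) (h' : (y, z) ∈ orientedRays c Γ) :
    (x, z) ∈ orientedRays c Γ ∧ c x z = c x y + c y z := by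
  obtain ⟨w, v, hwv, h⟩ := h
  obtain ⟨w', v', hwv', h'⟩ := h'
  simp only at h h'
  have f1 := cycleSet_ne_top hfin hwv
  have f2 := cycleSet_ne_top hfin hwv'
  obtain ⟨k1, k2⟩ := cycleSet_two_cycle hfin hmono hwv hwv'
  have g1 := f1
  have g2 := f2
  rw [← h] at g1
  rw [← h'] at g2
  simp only [ne_eq, ENNReal.add_eq_top, not_or] at g1 g2
  obtain ⟨⟨g3, g4⟩, g5⟩ := g1
  obtain ⟨⟨g6, g7⟩, g8⟩ := g2
  have e1 : c w' v ≤ c w' y + c y v := htri _ _ _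
  have e2 : c w v' ≤ c w x + c x z + c z v' :=
    (htri _ z _).trans (by gcongr; apply htri)
  have e3 : c x z ≤ c x y + c y z := htri _ _ _
  have f3 : c x z ≠ ∞ := ne_top_of_le_ne_top (ENNReal.add_ne_top.2 ⟨g4, g7⟩) e3
  have f4 : c w' v ≠ ∞ := ne_top_of_le_ne_top (ENNReal.add_ne_top.2 ⟨g6, g5⟩) e1
  have f5 : c w v' ≠ ∞ := ne_top_of_le_ne_top (by simp [g3, f3, g8]) e2
  have key : c x z = c x y + c y z ∧ c w' v + c w v' ≤ c w v + c w' v' ∧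
      c w x + c x z + c z v' = c w v' := by
    lift c w v to ℝ≥0 using f1 with wv
    lift c w' v' to ℝ≥0 using f2 with wv'
    lift c w' v to ℝ≥0 using f4 with w'v
    lift c w v' to ℝ≥0 using f5 with wv''
    lift c x z to ℝ≥0 using f3 with xz
    lift c w x to ℝ≥0 using g3 with wx
    lift c x y to ℝ≥0 using g4 with xy
    lift c y v to ℝ≥0 using g5 with yv
    lift c w' y to ℝ≥0 using g6 with w'y
    lift c y z to ℝ≥0 using g7 with yz
    lift c z v' to ℝ≥0 using g8 with zv'
    norm_cast at *
    simp only [← NNReal.coe_le_coe, ← NNReal.coe_inj, NNReal.coe_add] at *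
    refine ⟨?_, ?_, ?_⟩ <;> linarith
  exact ⟨⟨w, v', k2 key.2.1, key.2.2⟩, key.1⟩

theorem orientedRays_antisymm (hzero : ∀ x y, c x y = 0 ↔ x = y)
    (htri : ∀ x y z, c x z ≤ c x y + c y z)
    (hfin : ∀ p ∈ Γ, c p.1 p.2 ≠ ∞) (hmono : CyclicallyMonotone c Γ) {x y : X}
    (h : (x, y) ∈ orientedRays c Γ) (h' : (y, x) ∈ orientedRays c Γ) : x = y := by
  have := (orientedRays_trans htri hfin hmono h h').2
  rw [(hzero x x).2 rfl] at this
  exact (hzero x y).1 (add_eq_zero.1 this.symm).1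

theorem orientedRays_refl_left (hself : ∀ x, c x x = 0) (htri : ∀ x y z, c x z ≤ c x y + c y z)
    {x y : X} (h : (x, y) ∈ orientedRays c Γ) : (x, x) ∈ orientedRays c Γ :=
  orientedRays_of_between htri h (by simp [hself])

theorem orientedRays_refl_right (hself : ∀ x, c x x = 0) (htri : ∀ x y z, c x z ≤ c x y + c y z)
    {x y : X} (h : (x, y) ∈ orientedRays c Γ) : (y, y) ∈ orientedRays c Γ :=
  orientedRays_of_between htri h (by simp [hself])

end Rays

end GeodesicMonge

namespace GeodesicMonge

/-- The standing assumptions on the distance and on the cyclically monotone set. -/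
structure RaySetting {X : Type*} [MetricSpace X] [MeasurableSpace X] (c : X → X → ℝ≥0∞)
    (Γ : Set (X × X)) : Prop where
  dist : IsNonbranchingGeodesicDist c
  ne_top : ∀ p ∈ Γ, c p.1 p.2 ≠ ∞
  mono : CyclicallyMonotone c Γ

/-- The points of the oriented rays through `x`. -/
def ray {X : Type*} (c : X → X → ℝ≥0∞) (Γ : Set (X × X)) (x : X) : Set X :=
  {y | (x, y) ∈ orientedRays c Γ ∨ (y, x) ∈ orientedRays c Γ}

theorem mem_ray_comm {X : Type*} {c : X → X → ℝ≥0∞} {Γ : Set (X × X)}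
    {x y : X} : y ∈ ray c Γ x ↔ x ∈ ray c Γ y := or_comm

theorem mem_transportSet_of_between {X : Type*} {c : X → X → ℝ≥0∞} {Γ : Set (X × X)}
    {x y z : X} (hxy : x ≠ y) (hyz : y ≠ z)
    (h1 : (x, y) ∈ orientedRays c Γ)
    (h2 : (y, z) ∈ orientedRays c Γ) : y ∈ transportSet c Γ :=
  ⟨⟨x, hxy, h1⟩, ⟨z, hyz.symm, h2⟩⟩

/-! ### Unique prolongation of shortest paths. -/

section Branching

variable {X : Type*} [MetricSpace X] [MeasurableSpace X] {c : X → X → ℝ≥0∞}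

theorem IsNonbranchingGeodesicDist.self (h : IsNonbranchingGeodesicDist c) (x : X) : c x x = 0 :=
  (h.eq_zero_iff x x).2 rfl

theorem IsNonbranchingGeodesicDist.exists_between (h : IsNonbranchingGeodesicDist c) {x y : X}
    (hxy : c x y ≠ ∞) {a : ℝ≥0∞} (ha : a ≤ c x y) : ∃ m, c x m = a ∧ a + c m y = c x y := by
  obtain ⟨γ, hγ, h0, h1⟩ := h.geodesic x y hxy
  have ha' : a ≠ ∞ := ne_top_of_le_ne_top hxy ha
  have har : a.toReal ≤ (c x y).toReal := ENNReal.toReal_mono hxy ha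
  have m0 : (0 : ℝ) ∈ Icc 0 (c x y).toReal := ⟨le_rfl, ENNReal.toReal_nonneg⟩
  have m1 : (c x y).toReal ∈ Icc 0 (c x y).toReal := ⟨ENNReal.toReal_nonneg, le_rfl⟩
  have ma : a.toReal ∈ Icc 0 (c x y).toReal := ⟨ENNReal.toReal_nonneg, har⟩
  have e1 := hγ.2 _ m0 _ ma
  have e2 := hγ.2 _ ma _ m1
  rw [h0, zero_sub, abs_neg, abs_of_nonneg ENNReal.toReal_nonneg, ENNReal.ofReal_toReal ha'] at e1
  rw [h1, abs_sub_comm, abs_of_nonneg (sub_nonneg.2 har)] at e2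
  refine ⟨_, e1, ?_⟩
  rw [e2, ENNReal.ofReal_sub _ ENNReal.toReal_nonneg, ENNReal.ofReal_toReal ha',
    ENNReal.ofReal_toReal hxy, add_tsub_cancel_of_le ha]

/-- The non-branching axiom concerns midpoints only. Since `d ≤ δ`, one can go back from `x` towards
`u` by exactly `d`, to a point `m`; then `x` is a midpoint both of `m, y` and of `m, z`. -/
theorem IsNonbranchingGeodesicDist.eq_of_extend_le (h : IsNonbranchingGeodesicDist c)
    {u x y z : X} {δ d : ℝ≥0} (hd : d ≤ δ) (hux : c u x = δ) (hxy : c x y = d) (hxz : c x z = d)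
    (huy : c u y = δ + d) (huz : c u z = δ + d) : y = z := by
  have hle : ((δ - d : ℝ≥0) : ℝ≥0∞) ≤ c u x := by
    rw [hux]; exact_mod_cast tsub_le_self
  obtain ⟨m, hm1, hm2⟩ := h.exists_between (by simp [hux]) hle
  have hmx : c m x = d := by
    rw [hux] at hm2
    refine (ENNReal.add_right_inj (ENNReal.coe_ne_top (r := δ - d))).1 ?_
    rw [hm2]
    exact_mod_cast (tsub_add_cancel_of_le hd).symm
  have aux : ∀ v, c x v = d → c u v = δ + d → c m v = (2 * d : ℝ≥0) := by
    intro v hxv huv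
    have h1 : c m v ≤ d + d := by
      refine (h.triangle m x v).trans ?_
      rw [hmx, hxv]
    have h2 := h.triangle u m v
    rw [huv, hm1] at h2
    have h3 : c m v ≠ ∞ := ne_top_of_le_ne_top (by simp) h1
    lift c m v to ℝ≥0 using h3 with mv
    norm_cast at h1 h2 ⊢
    refine le_antisymm (by rw [two_mul]; exact h1) ?_
    rw [← NNReal.coe_le_coe] at h2 ⊢
    push_cast [NNReal.coe_sub hd] at h2 ⊢
    linarith
  have hr : (2 * d) / 2 = d := by field_simp
  refine h.nonbranching (2 * d) m x ?_ ⟨aux y hxy huy, ?_⟩ ⟨aux z hxz huz, ?_⟩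
  · rw [hmx, hr]
  · rw [mem_ofPred_eq, hxy, hr]
  · rw [mem_ofPred_eq, hxz, hr]

/-- Two shortest paths that prolong the same nontrivial one agree. -/
theorem IsNonbranchingGeodesicDist.eq_of_extend_mul (h : IsNonbranchingGeodesicDist c)
    {δ : ℝ≥0} (n : ℕ) : ∀ {u x y z : X} {d : ℝ≥0}, d ≤ n * δ → c u x = δ → c x y = d → c x z = d →
    c u y = δ + d → c u z = δ + d → y = z := by
  induction n with
  | zero =>
    intro u x y z d hd hux hxy hxz huy huz
    have hd0 : d = 0 := by simpa using hd
    subst hd0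
    rw [← (h.eq_zero_iff x y).1 (by simpa using hxy), ← (h.eq_zero_iff x z).1 (by simpa using hxz)]
  | succ n ih =>
    intro u x y z d hd hux hxy hxz huy huz
    rcases le_total d δ with hdδ | hdδ
    · exact h.eq_of_extend_le hdδ hux hxy hxz huy huz
    have aux : ∀ v, c x v = d → c u v = δ + d →
        ∃ m, c x m = δ ∧ c m v = (d - δ : ℝ≥0) ∧ c u m = δ + δ := by
      intro v hxv huv
      obtain ⟨m, hm1, hm2⟩ := h.exists_between (x := x) (y := v) (a := δ) (by simp [hxv])
        (by rw [hxv]; exact_mod_cast hdδ)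
      have hmv : c m v = (d - δ : ℝ≥0) := by
        refine (ENNReal.add_right_inj (ENNReal.coe_ne_top (r := δ))).1 ?_
        rw [hm2, hxv]
        exact_mod_cast (add_tsub_cancel_of_le hdδ).symm
      refine ⟨m, hm1, hmv, le_antisymm ?_ ?_⟩
      · refine (h.triangle u x m).trans ?_
        rw [hux, hm1]
      · have h2 := h.triangle u m v
        rw [huv, hmv] at h2
        refine (ENNReal.add_le_add_iff_right (ENNReal.coe_ne_top (r := d - δ))).1 (le_trans ?_ h2)
        rw [add_assoc]
        gcongr
        exact_mod_cast (add_tsub_cancel_of_le hdδ).le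
    obtain ⟨y', hy1, hy2, hy3⟩ := aux y hxy huy
    obtain ⟨z', hz1, hz2, hz3⟩ := aux z hxz huz
    -- The two prolongations share their first stretch of length `δ`. Then `x` and the end of this
    -- stretch replace `u` and `x`, and the length `d - δ ≤ n * δ` remains.
    obtain rfl := h.eq_of_extend_le le_rfl hux hy1 hz1 hy3 hz3
    have hsum : (d : ℝ≥0∞) = δ + (d - δ : ℝ≥0) := by
      exact_mod_cast (add_tsub_cancel_of_le hdδ).symm
    refine ih (d := d - δ) ?_ hy1 hy2 hz2 (by rw [hxy, ← hsum]) (by rw [hxz, ← hsum])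
    rw [tsub_le_iff_right]
    refine hd.trans (le_of_eq ?_)
    push_cast
    ring

theorem IsNonbranchingGeodesicDist.eq_of_extend (h : IsNonbranchingGeodesicDist c)
    {u x y z : X} (hux : u ≠ x) (hfin : c u x ≠ ∞) (hxy : c x y ≠ ∞) (hyz : c x y = c x z)
    (huy : c u y = c u x + c x y) (huz : c u z = c u x + c x z) : y = z := by
  rw [← hyz] at huz
  have h0 : c u x ≠ 0 := fun h' => hux ((h.eq_zero_iff _ _).1 h')
  generalize hδ : c u x = δ at *
  generalize hd : c x y = d at *
  lift δ to ℝ≥0 using hfin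
  lift d to ℝ≥0 using hxy
  have hδ0 : 0 < δ := pos_iff_ne_zero.2 (by simpa using h0)
  obtain ⟨n, hn⟩ := exists_nat_ge (d / δ)
  refine h.eq_of_extend_mul n ((div_le_iff₀ hδ0).1 hn) hδ hd hyz.symm huy huz

end Branching

/-! ### Rays as oriented, locally compact geodesics. -/

namespace RaySetting

variable {X : Type*} [MetricSpace X] [MeasurableSpace X] {c : X → X → ℝ≥0∞} {Γ : Set (X × X)}
  {x y z : X}

theorem trans (h : RaySetting c Γ) (h1 : (x, y) ∈ orientedRays c Γ)
    (h2 : (y, z) ∈ orientedRays c Γ) : (x, z) ∈ orientedRays c Γ :=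
  (orientedRays_trans h.dist.triangle h.ne_top h.mono h1 h2).1

theorem add (h : RaySetting c Γ) (h1 : (x, y) ∈ orientedRays c Γ)
    (h2 : (y, z) ∈ orientedRays c Γ) : c x z = c x y + c y z :=
  (orientedRays_trans h.dist.triangle h.ne_top h.mono h1 h2).2

theorem antisymm (h : RaySetting c Γ) (h1 : (x, y) ∈ orientedRays c Γ)
    (h2 : (y, x) ∈ orientedRays c Γ) : x = y :=
  orientedRays_antisymm h.dist.eq_zero_iff h.dist.triangle h.ne_top h.mono h1 h2

theorem refl_left (h : RaySetting c Γ) (h1 : (x, y) ∈ orientedRays c Γ) :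
    (x, x) ∈ orientedRays c Γ :=
  orientedRays_refl_left h.dist.self h.dist.triangle h1

theorem refl_right (h : RaySetting c Γ) (h1 : (x, y) ∈ orientedRays c Γ) :
    (y, y) ∈ orientedRays c Γ :=
  orientedRays_refl_right h.dist.self h.dist.triangle h1

theorem dist_ne_top (h : RaySetting c Γ) (h1 : (x, y) ∈ orientedRays c Γ) : c x y ≠ ∞ :=
  orientedRays_ne_top h.ne_top h1

theorem between (h : RaySetting c Γ) (h1 : (x, z) ∈ orientedRays c Γ)
    (h2 : c x y + c y z = c x z) :
    (x, y) ∈ orientedRays c Γ ∧ (y, z) ∈ orientedRays c Γ :=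
  ⟨orientedRays_of_between h.dist.triangle h1 (by simp [h.dist.self, h2]),
    orientedRays_of_between h.dist.triangle h1 (by simp [h.dist.self, h2])⟩

/-- The point at distance `c x y` from `x` on a shortest path to `z` prolongs the path from `u` to
`x` just as `y` does, so it is `y`. -/
theorem forward_of_le (h : RaySetting c Γ) {u : X} (hux : u ≠ x) (hu : (u, x) ∈ orientedRays c Γ)
    (hy : (x, y) ∈ orientedRays c Γ) (hz : (x, z) ∈ orientedRays c Γ) (hle : c x y ≤ c x z) :
    (y, z) ∈ orientedRays c Γ := by
  obtain ⟨m, hm1, hm2⟩ := h.dist.exists_between (h.dist_ne_top hz) hle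
  rw [← hm1] at hm2
  obtain ⟨h1, h2⟩ := h.between hz hm2
  obtain rfl := h.dist.eq_of_extend hux (h.dist_ne_top hu) (h.dist_ne_top hy) hm1.symm
    (h.add hu hy) (h.add hu h1)
  exact h2

theorem backward_of_le (h : RaySetting c Γ) {u : X} (hux : u ≠ x) (hu : (x, u) ∈ orientedRays c Γ)
    (hy : (y, x) ∈ orientedRays c Γ) (hz : (z, x) ∈ orientedRays c Γ) (hle : c x y ≤ c x z) :
    (z, y) ∈ orientedRays c Γ := by
  have symm := h.dist.symm
  have hz' : c x z ≠ ∞ := by rw [symm]; exact h.dist_ne_top hz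
  obtain ⟨m, hm1, hm2⟩ := h.dist.exists_between hz' hle
  rw [← hm1] at hm2
  obtain ⟨h1, h2⟩ := h.between (y := m) hz (by rw [add_comm, symm m x, symm z m, symm z x]; exact hm2)
  obtain rfl := h.dist.eq_of_extend (u := u) (x := x) (y := y) (z := m) hux
    (by rw [symm]; exact h.dist_ne_top hu)
    (by rw [symm]; exact h.dist_ne_top hy) hm1.symm
    (by rw [symm u y, h.add hy hu, add_comm, symm u x, symm x y])
    (by rw [symm u m, h.add h2 hu, add_comm, symm u x, symm x m])
  exact h1

theorem self_mem (h : RaySetting c Γ) (hx : x ∈ transportSet c Γ) : (x, x) ∈ orientedRays c Γ := by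
  obtain ⟨⟨u, -, hu⟩, -⟩ := hx
  exact h.refl_right hu

theorem self_mem_ray (h : RaySetting c Γ) (hx : x ∈ transportSet c Γ) : x ∈ ray c Γ x :=
  Or.inl (h.self_mem hx)

/-- The rays through a point of the transport set form a chain. -/
theorem comparable (h : RaySetting c Γ) (hx : x ∈ transportSet c Γ) (hy : y ∈ ray c Γ x)
    (hz : z ∈ ray c Γ x) : (y, z) ∈ orientedRays c Γ ∨ (z, y) ∈ orientedRays c Γ := by
  obtain ⟨⟨u, hux, hu⟩, ⟨v, hvx, hv⟩⟩ := hx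
  rcases hy with hy | hy <;> rcases hz with hz | hz
  · rcases le_total (c x y) (c x z) with hle | hle
    · exact Or.inl (h.forward_of_le hux hu hy hz hle)
    · exact Or.inr (h.forward_of_le hux hu hz hy hle)
  · exact Or.inr (h.trans hz hy)
  · exact Or.inl (h.trans hy hz)
  · rcases le_total (c x y) (c x z) with hle | hle
    · exact Or.inr (h.backward_of_le hvx hv hy hz hle)
    · exact Or.inl (h.backward_of_le hvx hv hz hy hle)

theorem ray_subset (h : RaySetting c Γ) (hx : x ∈ transportSet c Γ) (hy : y ∈ ray c Γ x) :
    ray c Γ x ⊆ ray c Γ y :=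
  fun _ hz => h.comparable hx hy hz

theorem ray_eq (h : RaySetting c Γ) (hx : x ∈ transportSet c Γ) (hy : y ∈ transportSet c Γ)
    (hyx : y ∈ ray c Γ x) : ray c Γ y = ray c Γ x :=
  (h.ray_subset hy (mem_ray_comm.1 hyx)).antisymm (h.ray_subset hx hyx)

open Classical in
/-- The signed arc length coordinate, with origin at `x`, on the ray through `x`. -/
noncomputable def signedCoord (c : X → X → ℝ≥0∞) (Γ : Set (X × X)) (x y : X) : ℝ :=
  if (x, y) ∈ orientedRays c Γ then (c x y).toReal else -(c x y).toReal

theorem dist_eq_signedCoord_sub (h : RaySetting c Γ) (hy : y ∈ ray c Γ x) (hz : z ∈ ray c Γ x)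
    (hyz : (y, z) ∈ orientedRays c Γ) :
    c y z = ENNReal.ofReal (signedCoord c Γ x z - signedCoord c Γ x y) ∧
      signedCoord c Γ x y ≤ signedCoord c Γ x z := by
  have hfin := h.dist_ne_top hyz
  suffices H : (c y z).toReal = signedCoord c Γ x z - signedCoord c Γ x y by
    refine ⟨by rw [← H, ENNReal.ofReal_toReal hfin], ?_⟩
    have : 0 ≤ (c y z).toReal := ENNReal.toReal_nonneg
    linarith
  unfold signedCoord
  by_cases hxy : (x, y) ∈ orientedRays c Γ
  · rw [if_pos hxy, if_pos (h.trans hxy hyz), h.add hxy hyz,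
      ENNReal.toReal_add (h.dist_ne_top hxy) hfin]
    ring
  · have hy' := hy.resolve_left hxy
    rw [if_neg hxy]
    by_cases hxz : (x, z) ∈ orientedRays c Γ
    · rw [if_pos hxz, h.add hy' hxz, ENNReal.toReal_add (h.dist_ne_top hy') (h.dist_ne_top hxz),
        h.dist.symm x y]
      ring
    · have hz' := hz.resolve_left hxz
      rw [if_neg hxz, h.dist.symm x y, h.dist.symm x z, h.add hyz hz',
        ENNReal.toReal_add hfin (h.dist_ne_top hz')]
      ring

/-- Coordinates between that of a point and the origin are attained, by betweenness; so the
coordinates of a ray fill an interval. -/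
theorem exists_signedCoord_eq (h : RaySetting c Γ) (hx : x ∈ transportSet c Γ) (hy : y ∈ ray c Γ x)
    {s : ℝ} (hs : 0 ≤ s ∧ s ≤ signedCoord c Γ x y ∨ signedCoord c Γ x y ≤ s ∧ s ≤ 0) :
    ∃ m ∈ ray c Γ x, signedCoord c Γ x m = s := by
  rcases eq_or_ne s 0 with rfl | hs0
  · exact ⟨x, h.self_mem_ray hx, by simp [signedCoord, h.dist.self]⟩
  have hnn : 0 ≤ (c x y).toReal := ENNReal.toReal_nonneg
  by_cases hxy : (x, y) ∈ orientedRays c Γ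
  · have e : signedCoord c Γ x y = (c x y).toReal := if_pos hxy
    have hs' : 0 < s ∧ s ≤ (c x y).toReal := by
      rw [e] at hs
      rcases hs with hs | hs
      · exact ⟨lt_of_le_of_ne hs.1 hs0.symm, hs.2⟩
      · exact absurd (le_antisymm hs.2 (hnn.trans hs.1)) hs0
    obtain ⟨m, hm1, hm2⟩ := h.dist.exists_between (h.dist_ne_top hxy)
      (ENNReal.ofReal_le_of_le_toReal hs'.2)
    rw [← hm1] at hm2
    have hxm := (h.between hxy hm2).1
    exact ⟨m, Or.inl hxm, by rw [signedCoord, if_pos hxm, hm1, ENNReal.toReal_ofReal hs'.1.le]⟩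
  · have e : signedCoord c Γ x y = -(c x y).toReal := if_neg hxy
    have hyx := hy.resolve_left hxy
    have hs' : 0 < -s ∧ -s ≤ (c x y).toReal := by
      rw [e] at hs
      rcases hs with hs | hs
      · exact absurd (le_antisymm (by linarith) hs.1) hs0
      · exact ⟨lt_of_le_of_ne (by linarith) (by simpa using hs0), by linarith⟩
    obtain ⟨m, hm1, hm2⟩ := h.dist.exists_between
      (by rw [h.dist.symm]; exact h.dist_ne_top hyx) (ENNReal.ofReal_le_of_le_toReal hs'.2)
    have hmx : (m, x) ∈ orientedRays c Γ := by
      refine (h.between hyx ?_).2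
      rw [h.dist.symm m x, h.dist.symm y x, ← hm2, hm1, add_comm, h.dist.symm y m]
    have hxm : (x, m) ∉ orientedRays c Γ := by
      intro hxm
      obtain rfl := h.antisymm hxm hmx
      rw [h.dist.self] at hm1
      have := ENNReal.ofReal_eq_zero.1 hm1.symm
      linarith
    exact ⟨m, Or.inr hmx, by
      rw [signedCoord, if_neg hxm, hm1, ENNReal.toReal_ofReal hs'.1.le, neg_neg]⟩

/-- The ray through a point of the transport set is an oriented geodesic. -/
theorem exists_geodesic (h : RaySetting c Γ) (hx : x ∈ transportSet c Γ) :
    ∃ (γ : ℝ → X) (I : Set ℝ), IsGeodesicOn c γ I ∧ γ '' I = ray c Γ x ∧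
      ∀ s ∈ I, ∀ t ∈ I, s ≤ t → (γ s, γ t) ∈ orientedRays c Γ := by
  classical
  have : Nonempty X := ⟨x⟩
  set τ := signedCoord c Γ x
  have hinj : InjOn τ (ray c Γ x) := by
    intro y hy z hz hyz
    rcases h.comparable hx hy hz with h' | h'
    · have := (h.dist_eq_signedCoord_sub hy hz h').1
      refine (h.dist.eq_zero_iff _ _).1 (this.trans ?_)
      simp only [τ] at hyz
      simp [hyz]
    · have := (h.dist_eq_signedCoord_sub hz hy h').1
      refine ((h.dist.eq_zero_iff _ _).1 (this.trans ?_)).symm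
      simp only [τ] at hyz
      simp [hyz]
  set γ := Function.invFunOn τ (ray c Γ x)
  have hγ : ∀ y ∈ ray c Γ x, γ (τ y) = y := fun y hy => hinj.leftInvOn_invFunOn hy
  refine ⟨γ, τ '' ray c Γ x, ⟨?_, ?_⟩, ?_, ?_⟩
  · refine ⟨?_⟩
    rintro _ ⟨y, hy, rfl⟩ _ ⟨z, hz, rfl⟩ s ⟨hs1, hs2⟩
    rcases le_total 0 s with hs | hs
    · exact h.exists_signedCoord_eq hx hz (Or.inl ⟨hs, hs2⟩)
    · exact h.exists_signedCoord_eq hx hy (Or.inr ⟨hs1, hs⟩)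
  · rintro _ ⟨y, hy, rfl⟩ _ ⟨z, hz, rfl⟩
    rw [hγ y hy, hγ z hz]
    rcases h.comparable hx hy hz with h' | h'
    · obtain ⟨h1, h2⟩ := h.dist_eq_signedCoord_sub hy hz h'
      rw [h1, abs_sub_comm, abs_of_nonneg (sub_nonneg.2 h2)]
    · obtain ⟨h1, h2⟩ := h.dist_eq_signedCoord_sub hz hy h'
      rw [h.dist.symm, h1, abs_of_nonneg (sub_nonneg.2 h2)]
  · rw [image_image]
    ext y
    constructor
    · rintro ⟨z, hz, rfl⟩
      simpa only [hγ z hz] using hz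
    · exact fun hy => ⟨y, hy, hγ y hy⟩
  · rintro _ ⟨y, hy, rfl⟩ _ ⟨z, hz, rfl⟩ hle
    rw [hγ y hy, hγ z hz]
    rcases h.comparable hx hy hz with h' | h'
    · exact h'
    · have h2 := (h.dist_eq_signedCoord_sub hz hy h').2
      rw [hinj hy hz (le_antisymm hle h2)] at h' ⊢
      exact h'

theorem exists_isCompact_ray_inter (h : RaySetting c Γ) (hx : x ∈ transportSet c Γ)
    (hy : y ∈ ray c Γ x) : ∃ r > 0, IsCompact (ray c Γ x ∩ Metric.closedBall y r) := by
  obtain ⟨γ, I, hγ, himg, -⟩ := h.exists_geodesic hx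
  obtain ⟨r, hr, hK⟩ := h.dist.locallyCompact γ I hγ y (himg ▸ hy)
  refine ⟨r, hr, ?_⟩
  have := hK.image_of_continuousOn ((h.dist.continuousOn γ I hγ).mono inter_subset_left)
  rwa [image_inter_preimage, himg] at this

/-- The part of a ray that lies strictly beyond `y` does not accumulate at `y`. -/
theorem exists_isOpen_separating (h : RaySetting c Γ) (hx : x ∈ transportSet c Γ)
    (hy : y ∈ ray c Γ x) (hz : z ∈ ray c Γ x) (hyz : (y, z) ∈ orientedRays c Γ) (hne : y ≠ z) :
    ∃ U : Set X, IsOpen U ∧ y ∈ U ∧ ∀ w ∈ U, w ∈ ray c Γ x → (z, w) ∉ orientedRays c Γ := by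
  obtain ⟨γ, I, hγ, himg, hord⟩ := h.exists_geodesic hx
  obtain ⟨r, hr, hK⟩ := h.dist.locallyCompact γ I hγ y (himg ▸ hy)
  rw [← himg] at hy hz
  obtain ⟨s, hs, rfl⟩ := hy
  obtain ⟨t, ht, rfl⟩ := hz
  have hst : s < t := by
    by_contra! hle
    exact hne (h.antisymm hyz (hord t ht s hs hle))
  have hinj : ∀ a ∈ I, ∀ b ∈ I, γ a = γ b → a = b := by
    intro a ha b hb hab
    have := hγ.2 a ha b hb
    rw [hab, h.dist.self] at this
    have := ENNReal.ofReal_eq_zero.1 this.symm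
    exact sub_eq_zero.1 (abs_nonpos_iff.1 this)
  -- Near `γ s` the part of the ray from `γ t` on is compact, hence closed, and it misses `γ s`.
  have hC : IsCompact (γ '' (I ∩ γ ⁻¹' Metric.closedBall (γ s) r ∩ Ici t)) :=
    (hK.inter_right isClosed_Ici).image_of_continuousOn
      ((h.dist.continuousOn γ I hγ).mono (inter_subset_left.trans inter_subset_left))
  refine ⟨Metric.ball (γ s) r ∩ (γ '' (I ∩ γ ⁻¹' Metric.closedBall (γ s) r ∩ Ici t))ᶜ,
    Metric.isOpen_ball.inter hC.isClosed.isOpen_compl, ⟨Metric.mem_ball_self hr, ?_⟩, ?_⟩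
  · rintro ⟨a, ⟨⟨ha, -⟩, hta⟩, has⟩
    have := hinj a ha s hs has
    rw [this] at hta
    exact absurd hst (not_lt.2 hta)
  · rintro w ⟨hw1, hw2⟩ hw hzw
    rw [← himg] at hw
    obtain ⟨a, ha, rfl⟩ := hw
    have hat : a < t := by
      by_contra! hle
      exact hw2 ⟨a, ⟨⟨ha, Metric.ball_subset_closedBall hw1⟩, hle⟩, rfl⟩
    have := h.antisymm hzw (hord a ha t ht hat.le)
    exact hat.ne' (hinj t ht a ha this)

/-- Two rays whose interior points have the same closure coincide. -/
theorem mem_ray_of_closure_eq (h : RaySetting c Γ) (hx : x ∈ transportSet c Γ)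
    (hy : y ∈ transportSet c Γ)
    (hcl : closure (transportSet c Γ ∩ ray c Γ x) = closure (transportSet c Γ ∩ ray c Γ y)) :
    y ∈ ray c Γ x := by
  obtain ⟨r, hr, hK⟩ := h.exists_isCompact_ray_inter hx (h.self_mem_ray hx)
  have hxcl : x ∈ closure (transportSet c Γ ∩ ray c Γ y) := by
    rw [← hcl]
    exact subset_closure ⟨hx, h.self_mem_ray hx⟩
  -- Near `x` the ray through `x` is closed. An interior point `z` of the other ray close to `x` is
  -- a limit of points of the ray through `x`, so it lies on it; two rays that share an interior
  -- point coincide.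
  obtain ⟨z, hz1, hzT, hz2⟩ := mem_closure_iff.1 hxcl _ Metric.isOpen_ball (Metric.mem_ball_self hr)
  have hzcl : z ∈ closure (ray c Γ x ∩ Metric.closedBall x r) := by
    have : z ∈ closure (transportSet c Γ ∩ ray c Γ x) := by
      rw [hcl]
      exact subset_closure ⟨hzT, hz2⟩
    rw [mem_closure_iff] at this ⊢
    intro o ho hzo
    obtain ⟨w, ⟨hw1, hw2⟩, -, hw3⟩ := this _ (ho.inter Metric.isOpen_ball) ⟨hzo, hz1⟩
    exact ⟨w, hw1, hw3, Metric.ball_subset_closedBall hw2⟩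
  rw [hK.isClosed.closure_eq] at hzcl
  rw [← h.ray_eq hx hzT hzcl.1, h.ray_eq hy hzT hz2]
  exact h.self_mem_ray hy

end RaySetting

end GeodesicMonge

/-! ### Universal measurability of analytic sets, and measurable factorization. -/

namespace MeasureTheory

theorem isCompact_box (n : ℕ → ℕ) : IsCompact {x : ℕ → ℕ | ∀ i, x i ≤ n i} := by
  have : {x : ℕ → ℕ | ∀ i, x i ≤ n i} = Set.univ.pi fun i => Iic (n i) := by
    ext; simp [Pi.le_def]
  rw [this]
  exact isCompact_univ_pi fun i => (finite_Iic (n i)).isCompact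

/-- Cylinders around a compact box in the Baire space are eventually contained in every open
neighbourhood of the box. -/
theorem exists_cylinder_subset_of_box_subset {n : ℕ → ℕ} {V : Set (ℕ → ℕ)} (hV : IsOpen V)
    (h : {x | ∀ i, x i ≤ n i} ⊆ V) : ∃ k, {x : ℕ → ℕ | ∀ i < k, x i ≤ n i} ⊆ V := by
  by_contra! hcon
  simp only [not_subset] at hcon
  choose x hx hxV using hcon
  have hK := isCompact_box n
  obtain ⟨y, hy, φ, hφ, hlim⟩ := hK.tendsto_subseq (x := fun k i => min (x k i) (n i))
    (fun k i => min_le_right _ _)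
  have hlim' : Filter.Tendsto (x ∘ φ) Filter.atTop (nhds y) := by
    rw [tendsto_pi_nhds] at hlim ⊢
    intro i
    refine (hlim i).congr' ?_
    filter_upwards [Filter.eventually_gt_atTop i] with k hk
    exact min_eq_left (hx (φ k) i (hk.trans_le (hφ.id_le k)))
  exact hV.isClosed_compl.mem_of_tendsto hlim' (Filter.Eventually.of_forall fun k => hxV (φ k)) (h hy)

/-- Analytic sets are approximated from inside by compact sets. -/
theorem AnalyticSet.exists_isCompact_subset {α : Type*} [TopologicalSpace α] [MeasurableSpace α]
    {s : Set α} (hs : AnalyticSet s) (μ : Measure α) [μ.OuterRegular] {a : ℝ≥0∞} (ha : a < μ s) :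
    ∃ K ⊆ s, IsCompact K ∧ a ≤ μ K := by
  rw [AnalyticSet] at hs
  rcases hs with rfl | ⟨f, hf, rfl⟩
  · simp at ha
  -- Continuity from below holds for the outer measure, so one coordinate at a time can be bounded
  -- while the strict inequality is kept.
  have step : ∀ (k : ℕ) (B : Set (ℕ → ℕ)), a < μ (f '' B) → ∃ m, a < μ (f '' (B ∩ {x | x k ≤ m})) := by
    intro k B hB
    have hU : f '' B = ⋃ m, f '' (B ∩ {x | x k ≤ m}) := by
      rw [← image_iUnion, ← inter_iUnion]
      congr 1
      refine (inter_eq_left.2 fun x _ => mem_iUnion.2 ⟨x k, le_refl (x k)⟩).symm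
    have hm : Monotone fun m => f '' (B ∩ {x | x k ≤ m}) := fun m m' h =>
      image_mono (inter_subset_inter_right _ fun x (hx : x k ≤ m) => hx.trans h)
    rw [hU, hm.measure_iUnion] at hB
    exact lt_iSup_iff.1 hB
  choose! m hm using step
  let B : ℕ → Set (ℕ → ℕ) := fun k => Nat.rec univ (fun k B => B ∩ {x | x k ≤ m k B}) k
  have hB : ∀ k, a < μ (f '' B k) := by
    intro k
    induction k with
    | zero => simpa [B] using ha
    | succ k ih => exact hm k (B k) ih
  set n : ℕ → ℕ := fun k => m k (B k)
  have hBn : ∀ k, B k = {x | ∀ i < k, x i ≤ n i} := by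
    intro k
    induction k with
    | zero => ext; simp [B]
    | succ k ih =>
      have : B (k + 1) = B k ∩ {x | x k ≤ n k} := rfl
      rw [this, ih]
      ext x
      simp only [mem_inter_iff, mem_ofPred_eq, Nat.lt_succ_iff]
      constructor
      · rintro ⟨h1, h2⟩ i hi
        rcases hi.lt_or_eq with h | rfl
        exacts [h1 i h, h2]
      · exact fun h => ⟨fun i hi => h i hi.le, h k le_rfl⟩
  have hK := isCompact_box n
  refine ⟨f '' {x | ∀ i, x i ≤ n i}, image_subset_range _ _, hK.image hf, ?_⟩
  -- Continuity from above is not available for images that may fail to be measurable. Open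
  -- neighbourhoods of the compact image replace it, as each contains the image of some cylinder `B
  -- k`.
  rw [Set.measure_eq_iInf_isOpen]
  refine le_iInf₂ fun V hKV => le_iInf fun hV => ?_
  obtain ⟨k, hk⟩ := exists_cylinder_subset_of_box_subset (hV.preimage hf) (image_subset_iff.1 hKV)
  refine (hB k).le.trans (measure_mono ?_)
  rw [hBn, image_subset_iff]
  exact hk

/-- Analytic sets are universally measurable. -/
theorem AnalyticSet.nullMeasurableSet {α : Type*} [TopologicalSpace α] [PolishSpace α]
    [MeasurableSpace α] [BorelSpace α] {s : Set α} (hs : AnalyticSet s) (μ : Measure α)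
    [IsFiniteMeasure μ] : NullMeasurableSet s μ := by
  rcases eq_or_ne (μ s) 0 with h0 | h0
  · exact NullMeasurableSet.of_null h0
  obtain ⟨u, -, hu, hlim⟩ := exists_seq_strictMono_tendsto' (pos_iff_ne_zero.2 h0)
  choose K hKs hK hKu using fun n => hs.exists_isCompact_subset μ (hu n).2
  have hmeas : MeasurableSet (⋃ n, K n) := MeasurableSet.iUnion fun n => (hK n).measurableSet
  have hle : μ s ≤ μ (⋃ n, K n) :=
    le_of_tendsto' hlim fun n => (hKu n).trans (measure_mono (subset_iUnion K n))
  exact (hmeas.nullMeasurableSet).congr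
    (ae_eq_of_subset_of_measure_ge (iUnion_subset hKs) hle hmeas.nullMeasurableSet
      (measure_ne_top μ s))

/-- A measurable map that is determined, on a measurable set, by the value of another measurable
map is there a measurable function of this value. -/
theorem exists_measurable_comp_eq_on {Z Y X : Type*} [MeasurableSpace Z] [StandardBorelSpace Z]
    [TopologicalSpace Y] [SecondCountableTopology Y] [T2Space Y] [MeasurableSpace Y] [BorelSpace Y]
    [MeasurableSpace X] [StandardBorelSpace X] [Nonempty X] {Ψ : Z → Y} {g : Z → X}
    (hΨ : Measurable Ψ) (hg : Measurable g) {s : Set Z} (hs : MeasurableSet s)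
    (h : ∀ z ∈ s, ∀ z' ∈ s, Ψ z = Ψ z' → g z = g z') :
    ∃ ρ : Y → X, Measurable ρ ∧ ∀ z ∈ s, ρ (Ψ z) = g z := by
  have hcomap : Measurable[MeasurableSpace.comap (fun z : s => Ψ z) inferInstance]
      (fun z : s => g z) := by
    intro V hV
    -- The images of the parts of `s` where `g` is in `V` and outside `V` are disjoint analytic
    -- sets; Lusin separation provides the Borel set.
    have h1 := (hs.inter (hg hV)).analyticSet_image hΨ
    have h2 := (hs.inter (hg hV.compl)).analyticSet_image hΨ
    have hdisj : Disjoint (Ψ '' (s ∩ g ⁻¹' V)) (Ψ '' (s ∩ g ⁻¹' Vᶜ)) := by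
      rw [Set.disjoint_left]
      rintro _ ⟨z, ⟨hz, hzV⟩, rfl⟩ ⟨z', ⟨hz', hzV'⟩, he⟩
      refine hzV' ?_
      rw [h z' hz' z hz he]
      exact hzV
    obtain ⟨u, hu1, hu2, hu⟩ := h1.measurablySeparable h2 hdisj
    refine ⟨u, hu, ?_⟩
    ext ⟨z, hz⟩
    constructor
    · intro hzu
      by_contra hzV
      exact Set.disjoint_left.1 hu2 ⟨z, ⟨hz, hzV⟩, rfl⟩ hzu
    · exact fun hzV => hu1 ⟨z, ⟨hz, hzV⟩, rfl⟩
  obtain ⟨ρ, hρ, he⟩ := hcomap.exists_eq_measurable_comp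
  exact ⟨ρ, hρ, fun z hz => (congrFun he ⟨z, hz⟩).symm⟩

end MeasureTheory

namespace MeasureTheory

open ProbabilityTheory

/-! ### The monotone rearrangement on a line -/

/-- The monotone rearrangement of `κ` into `κ'`. -/
noncomputable def rearrangement (κ κ' : Measure ℝ≥0∞) (s : ℝ≥0∞) : ℝ≥0∞ :=
  sInf {r | κ (Iic s) ≤ κ' (Iic r)}

/-- The infimum is attained, by continuity of `κ'` from above along a minimizing sequence; the set
is nonempty because it contains `⊤`. -/
theorem rearrangement_le_iff (κ κ' : Measure ℝ≥0∞) [IsProbabilityMeasure κ]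
    [IsProbabilityMeasure κ'] (s r : ℝ≥0∞) :
    rearrangement κ κ' s ≤ r ↔ κ (Iic s) ≤ κ' (Iic r) := by
  refine ⟨fun h => ?_, fun h => sInf_le h⟩
  have hne : {r | κ (Iic s) ≤ κ' (Iic r)}.Nonempty := by
    refine ⟨⊤, ?_⟩
    rw [mem_ofPred_eq, Iic_top, measure_univ]
    exact prob_le_one
  obtain ⟨u, hu, hlim, hmem⟩ := exists_seq_tendsto_sInf hne (OrderBot.bddBelow _)
  change Filter.Tendsto u Filter.atTop (nhds (rearrangement κ κ' s)) at hlim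
  have hI : Iic (rearrangement κ κ' s) = ⋂ n, Iic (u n) := by
    ext x
    simp only [mem_Iic, mem_iInter]
    exact ⟨fun hx n => hx.trans (sInf_le (hmem n)), fun hx => ge_of_tendsto' hlim hx⟩
  have ht := tendsto_measure_iInter_atTop (μ := κ') (s := fun n => Iic (u n))
    (fun n => measurableSet_Iic.nullMeasurableSet)
    (fun i j hij => Iic_subset_Iic.2 (hu hij)) ⟨0, measure_ne_top _ _⟩
  rw [← hI] at ht
  exact (ge_of_tendsto' ht hmem).trans (measure_mono (Iic_subset_Iic.2 h))

theorem monotone_rearrangement (κ κ' : Measure ℝ≥0∞) : Monotone (rearrangement κ κ') :=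
  fun _ _ h => sInf_le_sInf fun _ hr => (measure_mono (Iic_subset_Iic.2 h)).trans hr

/-- The distribution function of a diffuse law is uniformly distributed. -/
theorem measure_Iic_le_eq (κ : Measure ℝ≥0∞) [IsProbabilityMeasure κ] [NullSingletonClass κ] {c : ℝ≥0∞}
    (hc : c ≤ 1) : κ {s | κ (Iic s) ≤ c} = c := by
  set J := {s | κ (Iic s) ≤ c}
  have hlow : ∀ s ∈ J, ∀ s' ≤ s, s' ∈ J := fun s hs s' h =>
    (measure_mono (Iic_subset_Iic.2 h)).trans hs
  have h1 : Iio (sSup J) ⊆ J := fun s hs => by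
    obtain ⟨s', hs', h⟩ := lt_sSup_iff.1 (mem_Iio.1 hs)
    exact hlow s' hs' s h.le
  have h2 : J ⊆ Iic (sSup J) := fun s hs => le_sSup hs
  have hio : κ (Iio (sSup J)) = κ (Iic (sSup J)) := measure_congr Iio_ae_eq_Iic
  have hJ : κ J = κ (Iic (sSup J)) :=
    le_antisymm (measure_mono h2) (hio ▸ measure_mono h1)
  rw [hJ]
  -- Points of `J` that increase to `sSup J` give the upper bound, points outside `J` that decrease
  -- to it the lower one.
  apply le_antisymm
  · rw [← hio]
    rcases J.eq_empty_or_nonempty with h | h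
    · simp [h]
    obtain ⟨u, hu, hlim, hmem⟩ := exists_seq_tendsto_sSup h (OrderTop.bddAbove _)
    have hsub : Iio (sSup J) ⊆ ⋃ n, Iic (u n) := fun x hx => by
      obtain ⟨n, hn⟩ := ((tendsto_order.1 hlim).1 x hx).exists
      exact mem_iUnion.2 ⟨n, hn.le⟩
    refine (measure_mono hsub).trans ?_
    have hm : Monotone fun n => Iic (u n) := fun i j hij => Iic_subset_Iic.2 (hu hij)
    rw [hm.measure_iUnion]
    exact iSup_le hmem
  · rcases eq_or_ne (sSup J) ⊤ with h | h
    · rw [h, Iic_top, measure_univ]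
      exact hc
    obtain ⟨v, hv, hvm, hlim⟩ := exists_seq_strictAnti_tendsto' (lt_top_iff_ne_top.2 h)
    have hI : Iic (sSup J) = ⋂ n, Iic (v n) := by
      ext x
      simp only [mem_Iic, mem_iInter]
      exact ⟨fun hx n => hx.trans (hvm n).1.le, fun hx => ge_of_tendsto' hlim hx⟩
    have ht := tendsto_measure_iInter_atTop (μ := κ) (s := fun n => Iic (v n))
      (fun n => measurableSet_Iic.nullMeasurableSet)
      (fun i j hij => Iic_subset_Iic.2 (hv.antitone hij)) ⟨0, measure_ne_top _ _⟩
    rw [← hI] at ht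
    refine ge_of_tendsto' ht fun n => ?_
    by_contra! hlt
    exact (hvm n).1.not_ge (le_sSup hlt.le)

theorem map_rearrangement (κ κ' : Measure ℝ≥0∞) [IsProbabilityMeasure κ] [IsProbabilityMeasure κ']
    [NullSingletonClass κ] : κ.map (rearrangement κ κ') = κ' := by
  have hm := (monotone_rearrangement κ κ').measurable
  have : IsProbabilityMeasure (κ.map (rearrangement κ κ')) :=
    Measure.isProbabilityMeasure_map hm.aemeasurable
  refine Measure.ext_of_Iic _ _ fun r => ?_
  rw [Measure.map_apply hm measurableSet_Iic, ← measure_Iic_le_eq κ (c := κ' (Iic r)) prob_le_one]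
  congr 1
  ext s
  exact rearrangement_le_iff κ κ' s r

/-- If the rearrangement of `s` is less than `s`, some `q < s` in a countable dense set has `κ (Iic
s) ≤ κ (Iic q)`. For each `q` such `s` form a null set. -/
theorem ae_le_rearrangement (κ κ' : Measure ℝ≥0∞) [IsProbabilityMeasure κ]
    [IsProbabilityMeasure κ'] [NullSingletonClass κ] (h : ∀ r, κ' (Iic r) ≤ κ (Iic r)) :
    ∀ᵐ s ∂κ, s ≤ rearrangement κ κ' s := by
  obtain ⟨D, hDc, hD⟩ := TopologicalSpace.exists_countable_dense ℝ≥0∞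
  have hN : ∀ q ∈ D, κ ({s | κ (Iic s) ≤ κ (Iic q)} \ Iic q) = 0 := by
    intro q _
    have hsub : Iic q ⊆ {s | κ (Iic s) ≤ κ (Iic q)} := fun s hs =>
      measure_mono (Iic_subset_Iic.2 hs)
    rw [measure_sdiff hsub measurableSet_Iic.nullMeasurableSet (measure_ne_top _ _),
      measure_Iic_le_eq κ prob_le_one, tsub_self]
  refine measure_mono_null ?_ ((measure_biUnion_null_iff hDc).2 hN)
  intro s hs
  have hs : rearrangement κ κ' s < s := not_le.1 hs
  obtain ⟨q, hq, h1, h2⟩ := hD.exists_between hs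
  exact mem_biUnion hq ⟨((rearrangement_le_iff κ κ' s q).1 h1.le).trans (h q), not_le.2 h2⟩

/-- The length of the image of `[s, t)` under the monotone function `τ`. -/
noncomputable def arcCost (τ : ℝ≥0∞ → EReal) (s t : ℝ≥0∞) : ℝ≥0∞ :=
  volume {a : ℝ | τ s ≤ a ∧ (a : EReal) < τ t}

theorem measurableSet_arc {τ : ℝ≥0∞ → EReal} (hτ : Monotone τ) :
    MeasurableSet {p : (ℝ≥0∞ × ℝ≥0∞) × ℝ | τ p.1.1 ≤ p.2 ∧ (p.2 : EReal) < τ p.1.2} := by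
  have h := hτ.measurable
  have hr : Measurable fun p : (ℝ≥0∞ × ℝ≥0∞) × ℝ => (p.2 : EReal) :=
    measurable_coe_real_ereal.comp measurable_snd
  exact (measurableSet_le (h.comp (measurable_fst.comp measurable_fst)) hr).inter
    (measurableSet_lt hr (h.comp (measurable_snd.comp measurable_fst)))

theorem measurable_arcCost {τ : ℝ≥0∞ → EReal} (hτ : Monotone τ) :
    Measurable fun q : ℝ≥0∞ × ℝ≥0∞ => arcCost τ q.1 q.2 :=
  measurable_measure_prodMk_left (measurableSet_arc hτ)

/-- The cost of a forward plan depends on its marginals only. -/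
theorem lintegral_arcCost (p : Measure (ℝ≥0∞ × ℝ≥0∞)) [IsFiniteMeasure p]
    (hp : ∀ᵐ q ∂p, q.1 ≤ q.2) {τ : ℝ≥0∞ → EReal} (hτ : Monotone τ) :
    ∫⁻ q, arcCost τ q.1 q.2 ∂p =
      ∫⁻ a : ℝ, (p.map Prod.fst {s | τ s ≤ a} - p.map Prod.snd {s | τ s ≤ a}) := by
  have hE := measurableSet_arc hτ
  have h1 := Measure.prod_apply (μ := p) (ν := (volume : Measure ℝ)) hE
  have h2 := Measure.prod_apply_symm (μ := p) (ν := (volume : Measure ℝ)) hE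
  refine (h1.symm.trans h2).trans (lintegral_congr fun a => ?_)
  have hA : MeasurableSet {s | τ s ≤ a} := measurableSet_le hτ.measurable measurable_const
  rw [Measure.map_apply measurable_fst hA, Measure.map_apply measurable_snd hA]
  -- For a forward plan the event `τ q.2 ≤ a` is almost surely contained in `τ q.1 ≤ a`. The section
  -- at `a` is the difference of the two, so its measure depends on the marginals only.
  have hae : (Prod.snd ⁻¹' {s | τ s ≤ a} : Set (ℝ≥0∞ × ℝ≥0∞)) ≤ᵐ[p] Prod.fst ⁻¹' {s | τ s ≤ a} := by
    filter_upwards [hp] with q hq hqa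
    exact (hτ hq).trans hqa
  have hinter : p (Prod.fst ⁻¹' {s | τ s ≤ a} ∩ Prod.snd ⁻¹' {s | τ s ≤ a}) =
      p (Prod.snd ⁻¹' {s | τ s ≤ a}) := by
    refine measure_congr ?_
    filter_upwards [hae] with q hq
    exact propext ⟨fun h => h.2, fun h => ⟨hq h, h⟩⟩
  have hdiff := measure_inter_add_sdiff₀ (μ := p) (Prod.fst ⁻¹' {s | τ s ≤ a})
    (measurable_snd hA).nullMeasurableSet
  rw [hinter] at hdiff
  rw [← hdiff, ENNReal.add_sub_cancel_left (measure_ne_top _ _)]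
  congr 1
  ext q
  simp [not_le]

/-! ### Rearrangement along the fibers of a product -/

section Fiber

variable {L : Type*} [MeasurableSpace L]

/-- A measure that is null on the measurable partial sections has diffuse conditional laws. -/
theorem ae_nullSingletonClass_of_sections {m : Measure L} [SFinite m] {κ : Kernel L ℝ≥0∞}
    [IsMarkovKernel κ]
    (hsec : ∀ B : Set (L × ℝ≥0∞), MeasurableSet B →
      (∀ l s s', (l, s) ∈ B → (l, s') ∈ B → s = s') → (m ⊗ₘ κ) B = 0) :
    ∀ᵐ l ∂m, NullSingletonClass (κ l) := by
  -- `B U` collects the atoms that carry more than half of the mass of `U`. Each fiber has at most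
  -- one, so `B U` is a partial section; and every atom is of this kind for a small enough basic
  -- neighbourhood.
  let B : Set ℝ≥0∞ → Set (L × ℝ≥0∞) := fun U => {p | p.2 ∈ U ∧ κ p.1 U < 2 * κ p.1 {p.2}}
  have hsing : Measurable fun p : L × ℝ≥0∞ => κ p.1 {p.2} := by
    have hD : MeasurableSet {q : (L × ℝ≥0∞) × ℝ≥0∞ | q.2 = q.1.2} :=
      measurableSet_eq_fun measurable_snd (measurable_snd.comp measurable_fst)
    exact Kernel.measurable_kernel_prodMk_left (κ := κ.prodMkRight ℝ≥0∞) hD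
  have hB : ∀ U ∈ TopologicalSpace.countableBasis ℝ≥0∞, ∀ᵐ l ∂m, κ l (Prod.mk l ⁻¹' B U) = 0 := by
    intro U hU
    have hUm : MeasurableSet U := (TopologicalSpace.isOpen_of_mem_countableBasis hU).measurableSet
    have hBm : MeasurableSet (B U) :=
      (measurable_snd hUm).inter (measurableSet_lt
        ((κ.measurable_coe hUm).comp measurable_fst) (hsing.const_mul 2))
    have h0 := hsec (B U) hBm ?_
    · rwa [Measure.compProd_apply hBm,
        lintegral_eq_zero_iff (Kernel.measurable_kernel_prodMk_left hBm)] at h0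
    · rintro l s s' ⟨hs1, hs2⟩ ⟨hs1', hs2'⟩
      by_contra hne
      simp only at hs1 hs2 hs1' hs2'
      have hle : κ l {s} + κ l {s'} ≤ κ l U := by
        rw [← measure_union (by simpa using hne) (measurableSet_singleton _)]
        exact measure_mono (union_subset (singleton_subset_iff.2 hs1) (singleton_subset_iff.2 hs1'))
      have h2 : κ l U + κ l U < 2 * κ l {s} + 2 * κ l {s'} := ENNReal.add_lt_add hs2 hs2'
      rw [← mul_add, ← two_mul] at h2
      exact absurd h2 (not_lt.2 (by gcongr))
  have hall := (ae_ball_iff (TopologicalSpace.countable_countableBasis ℝ≥0∞)).2 hB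
  filter_upwards [hall] with l hl
  refine ⟨fun s => ?_⟩
  by_contra h0
  have hlt : κ l {s} < 2 * κ l {s} := by
    conv_lhs => rw [← one_mul (κ l {s})]
    exact ENNReal.mul_lt_mul_left h0 (measure_ne_top _ _) (by norm_num)
  obtain ⟨V, hsV, hV, hVlt⟩ := Set.exists_isOpen_lt_of_lt _ _ hlt
  obtain ⟨U, hU, hsU, hUV⟩ := (TopologicalSpace.isBasis_countableBasis ℝ≥0∞).exists_subset_of_mem_open
    (singleton_subset_iff.1 hsV) hV
  refine h0 (measure_mono_null ?_ (hl U hU))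
  exact singleton_subset_iff.2 ⟨hsU, (measure_mono hUV).trans_lt hVlt⟩

/-- The fiberwise monotone rearrangement of the two marginals of a forward plan. -/
theorem exists_fiber_rearrangement (P : Measure (L × (ℝ≥0∞ × ℝ≥0∞))) [IsFiniteMeasure P]
    (hP : ∀ᵐ q ∂P, q.2.1 ≤ q.2.2)
    (hsec : ∀ B : Set (L × ℝ≥0∞), MeasurableSet B →
      (∀ l s s', (l, s) ∈ B → (l, s') ∈ B → s = s') → P.map (Prod.map id Prod.fst) B = 0) :
    ∃ S : L × ℝ≥0∞ → ℝ≥0∞, Measurable S ∧ (∀ l, Monotone fun s => S (l, s)) ∧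
      (P.map (Prod.map id Prod.fst)).map (fun p => (p.1, S p)) = P.map (Prod.map id Prod.snd) ∧
      (∀ᵐ p ∂P.map (Prod.map id Prod.fst), p.2 ≤ S p) ∧
      ∀ C : L × (ℝ≥0∞ × ℝ≥0∞) → ℝ≥0∞, Measurable C → ∀ E F : Set (L × ℝ≥0∞),
        P.map (Prod.map id Prod.fst) Eᶜ = 0 → P.map (Prod.map id Prod.snd) Fᶜ = 0 →
        (∀ l, ∃ τ : ℝ≥0∞ → EReal, Monotone τ ∧
          ∀ s t, (l, s) ∈ E → (l, t) ∈ F → s ≤ t → C (l, (s, t)) = arcCost τ s t) →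
        ∫⁻ q, C q ∂P = ∫⁻ p, C (p.1, (p.2, S p)) ∂P.map (Prod.map id Prod.fst) := by
  set κ := P.condKernel
  set m := P.fst
  have hPκ : m ⊗ₘ κ = P := P.disintegrate κ
  set κ₁ : Kernel L ℝ≥0∞ := κ.map Prod.fst with hκ₁
  set κ₂ : Kernel L ℝ≥0∞ := κ.map Prod.snd with hκ₂
  have : IsMarkovKernel κ₁ := Kernel.IsMarkovKernel.map κ measurable_fst
  have : IsMarkovKernel κ₂ := Kernel.IsMarkovKernel.map κ measurable_snd
  have h1 : P.map (Prod.map id Prod.fst) = m ⊗ₘ κ₁ := by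
    rw [Measure.compProd_map measurable_fst, hPκ]
  have h2 : P.map (Prod.map id Prod.snd) = m ⊗ₘ κ₂ := by
    rw [Measure.compProd_map measurable_snd, hPκ]
  rw [h1] at hsec ⊢
  rw [h2]
  have hatom := ae_nullSingletonClass_of_sections hsec
  have hord : ∀ᵐ l ∂m, ∀ᵐ q ∂κ l, q.1 ≤ q.2 := by
    rw [← hPκ] at hP
    exact Measure.ae_ae_of_ae_compProd hP
  let S : L × ℝ≥0∞ → ℝ≥0∞ := fun p => rearrangement (κ₁ p.1) (κ₂ p.1) p.2
  have hS : Measurable S := by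
    refine measurable_of_Iic fun r => ?_
    have he : S ⁻¹' Iic r = {p | κ₁ p.1 (Iic p.2) ≤ κ₂ p.1 (Iic r)} := by
      ext p
      exact rearrangement_le_iff (κ₁ p.1) (κ₂ p.1) p.2 r
    rw [he]
    have hD : MeasurableSet {q : (L × ℝ≥0∞) × ℝ≥0∞ | q.2 ≤ q.1.2} :=
      measurableSet_le measurable_snd (measurable_snd.comp measurable_fst)
    exact measurableSet_le (Kernel.measurable_kernel_prodMk_left (κ := κ₁.prodMkRight ℝ≥0∞) hD)
      ((κ₂.measurable_coe measurableSet_Iic).comp measurable_fst)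
  have hmono : ∀ l, Monotone fun s => S (l, s) := fun l =>
    monotone_rearrangement (κ₁ l) (κ₂ l)
  have hpush : (m ⊗ₘ κ₁).map (fun p => (p.1, S p)) = m ⊗ₘ κ₂ := by
    ext A hA
    have hf : Measurable fun p : L × ℝ≥0∞ => (p.1, S p) := measurable_fst.prodMk hS
    rw [Measure.map_apply hf hA, Measure.compProd_apply (hf hA), Measure.compProd_apply hA]
    refine lintegral_congr_ae ?_
    filter_upwards [hatom] with l hl
    conv_rhs => rw [← map_rearrangement (κ₁ l) (κ₂ l)]
    rw [Measure.map_apply (hmono l).measurable (measurable_prodMk_left hA)]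
    rfl
  have hge : ∀ᵐ l ∂m, ∀ᵐ s ∂κ₁ l, s ≤ S (l, s) := by
    filter_upwards [hatom, hord] with l hl hlo
    -- The plan moves forward, so `q.2 ≤ r` forces `q.1 ≤ r`: the distribution functions are
    -- ordered.
    refine ae_le_rearrangement (κ₁ l) (κ₂ l) fun r => ?_
    rw [hκ₁, hκ₂, Kernel.map_apply _ measurable_fst, Kernel.map_apply _ measurable_snd,
      Measure.map_apply measurable_fst measurableSet_Iic,
      Measure.map_apply measurable_snd measurableSet_Iic]
    refine measure_mono_ae ?_
    filter_upwards [hlo] with q hq hqr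
    exact hq.trans hqr
  refine ⟨S, hS, hmono, hpush,
    Measure.ae_compProd_of_ae_ae (measurableSet_le measurable_snd hS) hge, ?_⟩
  · intro C hC E F hE hF hτ
    have hE' : ∀ᵐ l ∂m, ∀ᵐ s ∂κ₁ l, (l, s) ∈ E := Measure.ae_ae_of_ae_compProd hE
    have hF' : ∀ᵐ l ∂m, ∀ᵐ s ∂κ₂ l, (l, s) ∈ F := Measure.ae_ae_of_ae_compProd hF
    have hCS : Measurable fun p : L × ℝ≥0∞ => C (p.1, (p.2, S p)) :=
      hC.comp (measurable_fst.prodMk (measurable_snd.prodMk hS))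
    rw [← hPκ, Measure.lintegral_compProd hC, Measure.lintegral_compProd hCS]
    refine lintegral_congr_ae ?_
    filter_upwards [hE', hF', hord, hatom, hge] with l hEl hFl hlo hl hgel
    obtain ⟨τ, hτm, hCτ⟩ := hτ l
    have k1 : κ₁ l = (κ l).map Prod.fst := Kernel.map_apply _ measurable_fst _
    have k2 : κ₂ l = (κ l).map Prod.snd := Kernel.map_apply _ measurable_snd _
    have hSl : Measurable fun s => S (l, s) := (hmono l).measurable
    have hSmap : (κ₁ l).map (fun s => S (l, s)) = κ₂ l :=
      map_rearrangement (κ₁ l) (κ₂ l)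
    have hFS : ∀ᵐ s ∂κ₁ l, (l, S (l, s)) ∈ F := by
      rw [← hSmap] at hFl
      exact ae_of_ae_map hSl.aemeasurable hFl
    have e1 : ∫⁻ q, C (l, q) ∂κ l = ∫⁻ q, arcCost τ q.1 q.2 ∂κ l := by
      rw [k1] at hEl
      rw [k2] at hFl
      refine lintegral_congr_ae ?_
      filter_upwards [ae_of_ae_map measurable_fst.aemeasurable hEl,
        ae_of_ae_map measurable_snd.aemeasurable hFl, hlo] with q h1 h2 h3
      exact hCτ q.1 q.2 h1 h2 h3
    have e2 : ∫⁻ s, C (l, (s, S (l, s))) ∂κ₁ l = ∫⁻ s, arcCost τ s (S (l, s)) ∂κ₁ l := by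
      refine lintegral_congr_ae ?_
      filter_upwards [hEl, hFS, hgel] with s h1 h2 h3
      exact hCτ _ _ h1 h2 h3
    have hpair : Measurable fun s => (s, S (l, s)) := measurable_id.prodMk hSl
    have e3 : ∫⁻ s, arcCost τ s (S (l, s)) ∂κ₁ l =
        ∫⁻ q, arcCost τ q.1 q.2 ∂(κ₁ l).map fun s => (s, S (l, s)) :=
      (lintegral_map (measurable_arcCost hτm) hpair).symm
    have hfin : IsFiniteMeasure ((κ₁ l).map fun s => (s, S (l, s))) := inferInstance
    have hle' : ∀ᵐ q ∂(κ₁ l).map (fun s => (s, S (l, s))), q.1 ≤ q.2 :=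
      (ae_map_iff hpair.aemeasurable (measurableSet_le measurable_fst measurable_snd)).2 hgel
    -- On the fiber, the plan and the graph of the rearrangement are forward with the same
    -- marginals, hence have equal costs.
    rw [e1]
    refine Eq.trans ?_ (e2.trans e3).symm
    rw [lintegral_arcCost _ hlo hτm, lintegral_arcCost _ hle' hτm,
      Measure.map_map measurable_fst hpair, Measure.map_map measurable_snd hpair, ← k1, ← k2]
    simp only [Function.comp_def, Measure.map_id', hSmap]

end Fiber

end MeasureTheory

namespace MeasureTheory

theorem AnalyticSet.inter {α : Type*} [TopologicalSpace α] [T2Space α] {s t : Set α}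
    (hs : AnalyticSet s) (ht : AnalyticSet t) : AnalyticSet (s ∩ t) := by
  rw [inter_eq_iInter]
  exact AnalyticSet.iInter fun b => by cases b <;> assumption

theorem AnalyticSet.union {α : Type*} [TopologicalSpace α] {s t : Set α}
    (hs : AnalyticSet s) (ht : AnalyticSet t) : AnalyticSet (s ∪ t) := by
  rw [union_eq_iUnion]
  exact AnalyticSet.iUnion fun b => by cases b <;> assumption

end MeasureTheory

namespace GeodesicMonge

/-! ### The transport set and the evolution are analytic -/

section Analytic

variable {X : Type*} [MetricSpace X] [CompleteSpace X] [SecondCountableTopology X]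
  [MeasurableSpace X] [BorelSpace X] {c : X → X → ℝ≥0∞} {Γ : Set (X × X)}

theorem analyticSet_cycleSet (hc : Measurable (Function.uncurry c)) (hΓ : MeasurableSet Γ) :
    AnalyticSet (cycleSet c Γ) := by
  have he : cycleSet c Γ = ⋃ I : ℕ, (fun q : (Fin (I + 1) → X) × (Fin (I + 1) → X) =>
      (q.1 0, q.2 (Fin.last I))) '' {q | (∀ i, (q.1 i, q.2 i) ∈ Γ) ∧
        ∑ i, c (q.1 (i + 1)) (q.2 i) = ∑ i, c (q.1 i) (q.2 i)} := by
    ext p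
    simp only [mem_iUnion, mem_image, mem_ofPred_eq]
    constructor
    · rintro ⟨I, u, v, h1, h2, h3, h4⟩
      exact ⟨I, (u, v), ⟨h1, h4⟩, Prod.ext h2 h3⟩
    · rintro ⟨I, ⟨u, v⟩, ⟨h1, h4⟩, rfl⟩
      exact ⟨I, u, v, h1, rfl, rfl, h4⟩
  rw [he]
  have m1 : ∀ {I : ℕ} (i : Fin (I + 1)),
      Measurable fun q : (Fin (I + 1) → X) × (Fin (I + 1) → X) => q.1 i :=
    fun i => (measurable_pi_apply i).comp measurable_fst
  have m2 : ∀ {I : ℕ} (i : Fin (I + 1)),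
      Measurable fun q : (Fin (I + 1) → X) × (Fin (I + 1) → X) => q.2 i :=
    fun i => (measurable_pi_apply i).comp measurable_snd
  refine AnalyticSet.iUnion fun I => MeasurableSet.analyticSet_image (MeasurableSet.inter ?_ ?_)
    ((m1 0).prodMk (m2 _))
  · have : {q : (Fin (I + 1) → X) × (Fin (I + 1) → X) | ∀ i, (q.1 i, q.2 i) ∈ Γ} =
        ⋂ i, {q | (q.1 i, q.2 i) ∈ Γ} := by
      ext; simp
    change MeasurableSet {q : (Fin (I + 1) → X) × (Fin (I + 1) → X) | ∀ i, (q.1 i, q.2 i) ∈ Γ}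
    rw [this]
    exact MeasurableSet.iInter fun i => ((m1 i).prodMk (m2 i)) hΓ
  · exact measurableSet_eq_fun
      (Finset.measurable_sum _ fun i _ => hc.comp ((m1 (i + 1)).prodMk (m2 i)))
      (Finset.measurable_sum _ fun i _ => hc.comp ((m1 i).prodMk (m2 i)))

theorem analyticSet_orientedRays (hc : Measurable (Function.uncurry c)) (hΓ : MeasurableSet Γ) :
    AnalyticSet (orientedRays c Γ) := by
  have he : orientedRays c Γ = Prod.fst '' (Prod.snd ⁻¹' cycleSet c Γ ∩
      {q : (X × X) × (X × X) | c q.2.1 q.1.1 + c q.1.1 q.1.2 + c q.1.2 q.2.2 = c q.2.1 q.2.2}) := by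
    ext p
    constructor
    · rintro ⟨w, z, h1, h2⟩
      exact ⟨(p, (w, z)), ⟨h1, h2⟩, rfl⟩
    · rintro ⟨⟨p, w, z⟩, ⟨h1, h2⟩, rfl⟩
      exact ⟨w, z, h1, h2⟩
  rw [he]
  refine (((analyticSet_cycleSet hc hΓ).preimage continuous_snd).inter
    (MeasurableSet.analyticSet ?_)).image_of_continuous continuous_fst
  have hm : ∀ {f g : (X × X) × (X × X) → X}, Measurable f → Measurable g →
      Measurable fun q => c (f q) (g q) := fun hf hg => hc.comp (hf.prodMk hg)
  refine measurableSet_eq_fun (((hm ?_ ?_).add (hm ?_ ?_)).add (hm ?_ ?_)) (hm ?_ ?_) <;> fun_prop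

theorem analyticSet_exists_before (hc : Measurable (Function.uncurry c)) (hΓ : MeasurableSet Γ) :
    AnalyticSet {x | ∃ y, y ≠ x ∧ (y, x) ∈ orientedRays c Γ} := by
  have he : {x | ∃ y, y ≠ x ∧ (y, x) ∈ orientedRays c Γ} =
      Prod.snd '' ((diagonal X)ᶜ ∩ orientedRays c Γ) := by
    ext x
    constructor
    · rintro ⟨y, h1, h2⟩
      exact ⟨(y, x), ⟨h1, h2⟩, rfl⟩
    · rintro ⟨⟨y, x⟩, ⟨h1, h2⟩, rfl⟩
      exact ⟨y, h1, h2⟩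
  rw [he]
  exact (isClosed_diagonal.measurableSet.compl.analyticSet.inter
    (analyticSet_orientedRays hc hΓ)).image_of_continuous continuous_snd

theorem analyticSet_exists_after (hc : Measurable (Function.uncurry c)) (hΓ : MeasurableSet Γ) :
    AnalyticSet {x | ∃ y, y ≠ x ∧ (x, y) ∈ orientedRays c Γ} := by
  have he : {x | ∃ y, y ≠ x ∧ (x, y) ∈ orientedRays c Γ} =
      Prod.fst '' ((diagonal X)ᶜ ∩ orientedRays c Γ) := by
    ext x
    constructor
    · rintro ⟨y, h1, h2⟩
      exact ⟨(x, y), ⟨h1.symm, h2⟩, rfl⟩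
    · rintro ⟨⟨x, y⟩, ⟨h1, h2⟩, rfl⟩
      exact ⟨y, Ne.symm h1, h2⟩
  rw [he]
  exact (isClosed_diagonal.measurableSet.compl.analyticSet.inter
    (analyticSet_orientedRays hc hΓ)).image_of_continuous continuous_fst

theorem analyticSet_transportSet (hc : Measurable (Function.uncurry c)) (hΓ : MeasurableSet Γ) :
    AnalyticSet (transportSet c Γ) :=
  (analyticSet_exists_before hc hΓ).inter (analyticSet_exists_after hc hΓ)

theorem analyticSet_transportSetE (hc : Measurable (Function.uncurry c)) (hΓ : MeasurableSet Γ) :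
    AnalyticSet (transportSetE c Γ) :=
  (analyticSet_exists_before hc hΓ).union (analyticSet_exists_after hc hΓ)

theorem analyticSet_rayMap (hc : Measurable (Function.uncurry c)) (hΓ : MeasurableSet Γ) :
    AnalyticSet (rayMap c Γ) := by
  have hG := analyticSet_orientedRays hc hΓ
  have hm : Measurable fun p : X × ℝ × X => c p.1 p.2.2 :=
    hc.comp (measurable_fst.prodMk (measurable_snd.comp measurable_snd))
  have hs : Measurable fun p : X × ℝ × X => p.2.1 := measurable_fst.comp measurable_snd
  refine ((analyticSet_transportSet hc hΓ).preimage continuous_fst).inter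
    (AnalyticSet.union (AnalyticSet.inter ?_ (AnalyticSet.inter ?_ ?_))
      (AnalyticSet.inter ?_ (AnalyticSet.inter ?_ ?_)))
  · exact (measurableSet_le measurable_const hs).analyticSet
  · exact hG.preimage (f := fun p : X × ℝ × X => (p.1, p.2.2)) (by fun_prop)
  · exact (measurableSet_eq_fun hm hs.ennreal_ofReal).analyticSet
  · exact (measurableSet_lt hs measurable_const).analyticSet
  · exact hG.preimage (f := fun p : X × ℝ × X => (p.2.2, p.1)) (by fun_prop)
  · exact (measurableSet_eq_fun hm hs.neg.ennreal_ofReal).analyticSet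

theorem analyticSet_evolution (hc : Measurable (Function.uncurry c)) (hΓ : MeasurableSet Γ)
    {A : Set X} (hA : MeasurableSet A) (t : ℝ) : AnalyticSet (evolution c Γ A t) := by
  have hR := analyticSet_rayMap hc hΓ
  have he : evolution c Γ A t = (fun q : X × ℝ × X × X => q.2.2.2) ''
      ((fun q => q.2.2.1) ⁻¹' A ∩ ((fun q => (q.1, q.2.1, q.2.2.1)) ⁻¹' rayMap c Γ ∩
        (fun q => (q.1, q.2.1 + t, q.2.2.2)) ⁻¹' rayMap c Γ)) := by
    ext z
    constructor
    · rintro ⟨y, s, x, h1, h2, h3⟩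
      exact ⟨(y, s, x, z), ⟨h1, h2, h3⟩, rfl⟩
    · rintro ⟨⟨y, s, x, z⟩, ⟨h1, h2, h3⟩, rfl⟩
      exact ⟨y, s, x, h1, h2, h3⟩
  rw [he]
  refine AnalyticSet.image_of_continuous (AnalyticSet.inter ?_ (AnalyticSet.inter ?_ ?_))
    (by fun_prop)
  · exact hA.analyticSet.preimage (by fun_prop)
  · exact hR.preimage (by fun_prop)
  · exact hR.preimage (by fun_prop)

end Analytic

/-! ### Partial sections are negligible -/

namespace RaySetting

variable {X : Type*} [MetricSpace X] [MeasurableSpace X] {c : X → X → ℝ≥0∞} {Γ : Set (X × X)}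

theorem signedCoord_of_mem_rayMap (h : RaySetting c Γ) {x y : X} {s : ℝ}
    (hx : (y, s, x) ∈ rayMap c Γ) : x ∈ ray c Γ y ∧ signedCoord c Γ y x = s := by
  obtain ⟨-, ⟨hs, h1, h2⟩ | ⟨hs, h1, h2⟩⟩ := hx
  · simp only at hs h1 h2
    exact ⟨Or.inl h1, by rw [signedCoord, if_pos h1, h2, ENNReal.toReal_ofReal hs]⟩
  · simp only at hs h1 h2
    refine ⟨Or.inr h1, ?_⟩
    rw [signedCoord, if_neg, h2, ENNReal.toReal_ofReal (by linarith), neg_neg]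
    intro h3
    obtain rfl := h.antisymm h1 h3
    rw [h.dist.self] at h2
    have := ENNReal.ofReal_eq_zero.1 h2.symm
    linarith

theorem of_mem_evolution (h : RaySetting c Γ) {A : Set X} {z : X} {t : ℝ} (ht : 0 < t)
    (hz : z ∈ evolution c Γ A t) : ∃ x ∈ A, (x, z) ∈ orientedRays c Γ ∧ c x z = ENNReal.ofReal t ∧
      ∃ y ∈ transportSet c Γ, x ∈ ray c Γ y ∧ z ∈ ray c Γ y := by
  obtain ⟨y, s, x, hxA, hx, hz⟩ := hz
  have hy : y ∈ transportSet c Γ := hx.1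
  obtain ⟨hx1, hx2⟩ := h.signedCoord_of_mem_rayMap hx
  obtain ⟨hz1, hz2⟩ := h.signedCoord_of_mem_rayMap hz
  have hxz : (x, z) ∈ orientedRays c Γ := by
    refine (h.comparable hy hx1 hz1).resolve_right fun hzx => ?_
    have := (h.dist_eq_signedCoord_sub hz1 hx1 hzx).2
    linarith
  refine ⟨x, hxA, hxz, ?_, y, hy, hx1, hz1⟩
  rw [(h.dist_eq_signedCoord_sub hx1 hz1 hxz).1, hx2, hz2, add_sub_cancel_left]

theorem ne_of_dist_eq_ofReal (h : RaySetting c Γ) {x z : X} {t : ℝ} (ht : 0 < t)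
    (hxz : c x z = ENNReal.ofReal t) : x ≠ z := by
  rintro rfl
  rw [h.dist.self] at hxz
  exact absurd (ENNReal.ofReal_eq_zero.1 hxz.symm) (not_le.2 ht)

variable [CompleteSpace X] [SecondCountableTopology X] [BorelSpace X] {μ : Measure X}
  [IsFiniteMeasure μ]

/-- Final points have nothing beyond them: all their forward translates are empty, against
non-degeneracy. -/
theorem measure_final_points (h : RaySetting c Γ) (hΓ : MeasurableSet Γ)
    (hnd : NonDegenerate c Γ μ) :
    μ (transportSetE c Γ \ {x | ∃ y, y ≠ x ∧ (x, y) ∈ orientedRays c Γ}) = 0 := by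
  have hm := h.dist.measurable
  have hnull := ((analyticSet_transportSetE hm hΓ).nullMeasurableSet μ).diff
    ((analyticSet_exists_after hm hΓ).nullMeasurableSet μ)
  obtain ⟨A, hA, hAm, hAe⟩ := hnull.exists_measurable_subset_ae_eq
  by_contra h0
  rw [← measure_congr hAe] at h0
  refine hnd A hAm (hA.trans sdiff_subset) (pos_iff_ne_zero.2 h0) ?_
  refine countable_empty.mono ?_
  rintro t ⟨ht, hpos⟩
  refine hpos.ne' (measure_mono_null (t := ∅) ?_ measure_empty)
  intro z hz
  obtain ⟨x, hxA, hxz, hd, -⟩ := h.of_mem_evolution ht hz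
  exact (hA hxA).2 ⟨z, (h.ne_of_dist_eq_ofReal ht hd).symm, hxz⟩

/-- A set that meets every oriented ray in one point at most is negligible. -/
theorem measure_antichain (h : RaySetting c Γ) (hΓ : MeasurableSet Γ)
    (hnd : NonDegenerate c Γ μ) {A : Set X} (hAm : NullMeasurableSet A μ)
    (hA : A ⊆ transportSetE c Γ)
    (hanti : ∀ x ∈ A, ∀ x' ∈ A, (x, x') ∈ orientedRays c Γ → x = x') : μ A = 0 := by
  have hm := h.dist.measurable
  obtain ⟨B, hBA, hBm, hBe⟩ := hAm.exists_measurable_subset_ae_eq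
  by_contra h0
  rw [← measure_congr hBe] at h0
  refine hnd B hBm (hBA.trans hA) (pos_iff_ne_zero.2 h0) ?_
  have hc := Measure.countable_meas_pos_of_disjoint_iUnion₀ (μ := μ)
    (As := fun t : {t : ℝ // 0 < t} => evolution c Γ B t ∩ transportSet c Γ)
    (fun t => ((analyticSet_evolution hm hΓ hBm t).inter
      (analyticSet_transportSet hm hΓ)).nullMeasurableSet μ) ?_
  · refine (hc.image Subtype.val).mono ?_
    rintro t ⟨ht, hpos⟩
    refine ⟨⟨t, ht⟩, hpos.trans_le ?_, rfl⟩
    -- Translates could overlap at final points, where rays may meet. These are negligible, so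
    -- intersecting with `transportSet` loses no mass.
    have hsub : evolution c Γ B t ⊆ (evolution c Γ B t ∩ transportSet c Γ) ∪
        (transportSetE c Γ \ {x | ∃ y, y ≠ x ∧ (x, y) ∈ orientedRays c Γ}) := by
      intro z hz
      by_cases hzT : z ∈ transportSet c Γ
      · exact Or.inl ⟨hz, hzT⟩
      · obtain ⟨x, hxA, hxz, hd, -⟩ := h.of_mem_evolution ht hz
        have hb : ∃ y, y ≠ z ∧ (y, z) ∈ orientedRays c Γ :=
          ⟨x, h.ne_of_dist_eq_ofReal ht hd, hxz⟩
        exact Or.inr ⟨Or.inl hb, fun ha => hzT ⟨hb, ha⟩⟩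
    refine (measure_mono hsub).trans ((measure_union_le _ _).trans ?_)
    rw [h.measure_final_points hΓ hnd, add_zero]
  · intro t t' htt'
    refine Disjoint.aedisjoint (Set.disjoint_left.2 ?_)
    rintro z ⟨hz, hzT⟩ ⟨hz', -⟩
    refine htt' (Subtype.ext ?_)
    obtain ⟨x, hxB, -, hd, y, hy, hxy, hzy⟩ := h.of_mem_evolution t.2 hz
    obtain ⟨x', hxB', -, hd', y', hy', hxy', hzy'⟩ := h.of_mem_evolution t'.2 hz'
    rw [← h.ray_eq hy hzT hzy] at hxy
    rw [← h.ray_eq hy' hzT hzy'] at hxy'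
    -- Both points lie on the ray of the interior point `z`, so they are comparable and hence equal;
    -- `t` and `t'` are then the same distance to `z`.
    have hxx : x = x' := by
      rcases h.comparable hzT hxy hxy' with h1 | h1
      · exact hanti x (hBA hxB) x' (hBA hxB') h1
      · exact (hanti x' (hBA hxB') x (hBA hxB) h1).symm
    rw [hxx, hd'] at hd
    exact ((ENNReal.ofReal_eq_ofReal_iff t'.2.le t.2.le).1 hd).symm

/-- An initial point has no predecessor, so the initial points form an antichain. -/
theorem measure_end_points (h : RaySetting c Γ) (hΓ : MeasurableSet Γ)
    (hnd : NonDegenerate c Γ μ) : μ (transportSetE c Γ \ transportSet c Γ) = 0 := by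
  have hm := h.dist.measurable
  have hinit : μ (transportSetE c Γ \ {x | ∃ y, y ≠ x ∧ (y, x) ∈ orientedRays c Γ}) = 0 := by
    refine h.measure_antichain hΓ hnd
      (((analyticSet_transportSetE hm hΓ).nullMeasurableSet μ).diff
        ((analyticSet_exists_before hm hΓ).nullMeasurableSet μ)) sdiff_subset ?_
    rintro x - x' ⟨-, hx'⟩ hxx'
    by_contra hne
    exact hx' ⟨x, hne, hxx'⟩
  refine measure_mono_null ?_ (measure_union_null hinit (h.measure_final_points hΓ hnd))
  rintro x ⟨hx, hxT⟩
  by_cases hb : ∃ y, y ≠ x ∧ (y, x) ∈ orientedRays c Γ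
  · exact Or.inr ⟨hx, fun ha => hxT ⟨hb, ha⟩⟩
  · exact Or.inl ⟨hx, hb⟩

end RaySetting

end GeodesicMonge

namespace GeodesicMonge

/-! ### Measurable labels and coordinates for the rays -/

section Coordinates

variable {X : Type*}

/-- The points of the oriented rays that lie before a point of `V`. -/
def before (c : X → X → ℝ≥0∞) (Γ : Set (X × X)) (V : Set X) : Set X :=
  {y | ∃ z ∈ V, (y, z) ∈ orientedRays c Γ}

/-- An order-preserving coordinate along the rays, built from a sequence of sets `U`. -/
noncomputable def height (c : X → X → ℝ≥0∞) (Γ : Set (X × X)) (U : ℕ → Set X) (x : X) : ℝ≥0∞ :=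
  ∑' n, indicator (before c Γ (U n))ᶜ (fun _ => 2⁻¹ ^ n) x

/-- The label of a ray: the indices of the sets of the sequence `U` that its interior meets. -/
noncomputable def label (c : X → X → ℝ≥0∞) (Γ : Set (X × X)) (U : ℕ → Set X) (x : X) (n : ℕ) :
    ℝ≥0∞ :=
  indicator {y | ∃ z ∈ U n, z ∈ transportSet c Γ ∧ z ∈ ray c Γ y} (fun _ => 1) x

theorem height_ne_top (c : X → X → ℝ≥0∞) (Γ : Set (X × X)) (U : ℕ → Set X) (x : X) :
    height c Γ U x ≠ ∞ := by
  refine ne_top_of_le_ne_top (b := ∑' n : ℕ, (2⁻¹ : ℝ≥0∞) ^ n) ?_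
    (ENNReal.tsum_le_tsum fun n => indicator_le_self _ _ _)
  rw [ENNReal.tsum_geometric, ENNReal.one_sub_inv_two, inv_inv]
  exact ENNReal.ofNat_ne_top

end Coordinates

namespace RaySetting

section Order

variable {X : Type*} [MetricSpace X] [MeasurableSpace X] {c : X → X → ℝ≥0∞} {Γ : Set (X × X)}
  {U : ℕ → Set X} {x y z : X}

theorem indicator_before_le (h : RaySetting c Γ) (V : Set X) (a : ℝ≥0∞)
    (hyz : (y, z) ∈ orientedRays c Γ) :
    indicator (before c Γ V)ᶜ (fun _ => a) y ≤ indicator (before c Γ V)ᶜ (fun _ => a) z := by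
  by_cases hz : z ∈ before c Γ V
  · obtain ⟨w, hw, hzw⟩ := hz
    have hy : y ∈ before c Γ V := ⟨w, hw, h.trans hyz hzw⟩
    rw [indicator_of_notMem (notMem_compl_iff.2 hy)]
    exact zero_le
  · rw [indicator_of_mem (mem_compl hz)]
    exact indicator_le_self _ _ _

theorem height_le (h : RaySetting c Γ) (U : ℕ → Set X) (hyz : (y, z) ∈ orientedRays c Γ) :
    height c Γ U y ≤ height c Γ U z :=
  ENNReal.tsum_le_tsum fun _ => h.indicator_before_le _ _ hyz

/-- Some basic open set contains `y` but no point of the ray from `z` on; its term in the series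
jumps between `y` and `z`. -/
theorem height_lt (h : RaySetting c Γ) (hU : TopologicalSpace.IsTopologicalBasis (range U))
    (hx : x ∈ transportSet c Γ) (hy : y ∈ ray c Γ x) (hz : z ∈ ray c Γ x)
    (hyz : (y, z) ∈ orientedRays c Γ) (hne : y ≠ z) : height c Γ U y < height c Γ U z := by
  obtain ⟨V, hV, hyV, hsep⟩ := h.exists_isOpen_separating hx hy hz hyz hne
  obtain ⟨-, ⟨n, rfl⟩, hyn, hnV⟩ := hU.exists_subset_of_mem_open hyV hV
  -- The delicate case is `z` strictly before `x`: then `z`, having `y` strictly before it, is an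
  -- interior point and has the same ray as `x`.
  have hray : ∀ w, (z, w) ∈ orientedRays c Γ → w ∈ ray c Γ x := by
    intro w hzw
    rcases hz with hz | hz
    · exact Or.inl (h.trans hz hzw)
    · rcases eq_or_ne z x with rfl | hzx
      · exact Or.inl hzw
      · have hzT := mem_transportSet_of_between hne hzx hyz hz
        rw [← h.ray_eq hx hzT (Or.inr hz)]
        exact Or.inl hzw
  have hy' : y ∈ before c Γ (U n) := ⟨y, hyn, h.refl_left hyz⟩
  have hz' : z ∉ before c Γ (U n) := by
    rintro ⟨w, hw, hzw⟩
    exact hsep w (hnV hw) (hray w hzw) hzw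
  refine ENNReal.tsum_lt_tsum (i := n) (height_ne_top c Γ U y)
    (fun m => h.indicator_before_le _ _ hyz) ?_
  rw [indicator_of_notMem (notMem_compl_iff.2 hy'), indicator_of_mem (mem_compl hz')]
  exact ENNReal.pow_pos (by simp) n

theorem of_height_le (h : RaySetting c Γ) (hU : TopologicalSpace.IsTopologicalBasis (range U))
    (hx : x ∈ transportSet c Γ) (hy : y ∈ ray c Γ x) (hz : z ∈ ray c Γ x)
    (hle : height c Γ U y ≤ height c Γ U z) : (y, z) ∈ orientedRays c Γ := by
  rcases h.comparable hx hy hz with h' | h'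
  · exact h'
  · rcases eq_or_ne z y with rfl | hne
    · exact h'
    · exact absurd hle (not_le.2 (h.height_lt hU hx hz hy h' hne))

theorem eq_of_height_eq (h : RaySetting c Γ) (hU : TopologicalSpace.IsTopologicalBasis (range U))
    (hx : x ∈ transportSet c Γ) (hy : y ∈ ray c Γ x) (hz : z ∈ ray c Γ x)
    (he : height c Γ U y = height c Γ U z) : y = z :=
  h.antisymm (h.of_height_le hU hx hy hz he.le) (h.of_height_le hU hx hz hy he.ge)

theorem label_eq (h : RaySetting c Γ) (U : ℕ → Set X) (hx : x ∈ transportSet c Γ)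
    (hy : y ∈ transportSet c Γ) (hyx : y ∈ ray c Γ x) : label c Γ U y = label c Γ U x := by
  ext n
  have hiff : y ∈ {y | ∃ z ∈ U n, z ∈ transportSet c Γ ∧ z ∈ ray c Γ y} ↔
      x ∈ {y | ∃ z ∈ U n, z ∈ transportSet c Γ ∧ z ∈ ray c Γ y} := by
    simp only [mem_ofPred_eq, h.ray_eq hx hy hyx]
  unfold label
  by_cases hm : x ∈ {y | ∃ z ∈ U n, z ∈ transportSet c Γ ∧ z ∈ ray c Γ y}
  · rw [indicator_of_mem (hiff.2 hm), indicator_of_mem hm]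
  · rw [indicator_of_notMem (fun hy' => hm (hiff.1 hy')), indicator_of_notMem hm]

theorem mem_ray_of_label_eq (h : RaySetting c Γ)
    (hU : TopologicalSpace.IsTopologicalBasis (range U))
    (hx : x ∈ transportSet c Γ) (hy : y ∈ transportSet c Γ)
    (he : label c Γ U y = label c Γ U x) : y ∈ ray c Γ x := by
  refine h.mem_ray_of_closure_eq hx hy ?_
  have hiff : ∀ n, (∃ z ∈ U n, z ∈ transportSet c Γ ∧ z ∈ ray c Γ y) ↔
      ∃ z ∈ U n, z ∈ transportSet c Γ ∧ z ∈ ray c Γ x := by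
    intro n
    have hn := congrFun he n
    simp only [label, indicator, mem_ofPred_eq] at hn
    split_ifs at hn with h1 h2 h2
    · exact iff_of_true h1 h2
    · simp at hn
    · simp at hn
    · exact iff_of_false h1 h2
  ext p
  rw [hU.mem_closure_iff, hU.mem_closure_iff]
  simp only [forall_mem_range]
  refine forall_congr' fun n => imp_congr_right fun _ => ?_
  exact (hiff n).symm

theorem exists_arcCost_eq (h : RaySetting c Γ)
    (hU : TopologicalSpace.IsTopologicalBasis (range U)) (hx : x ∈ transportSet c Γ) :
    ∃ τ : ℝ≥0∞ → EReal, Monotone τ ∧ ∀ y ∈ ray c Γ x, ∀ z ∈ ray c Γ x,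
      (y, z) ∈ orientedRays c Γ → c y z = arcCost τ (height c Γ U y) (height c Γ U z) := by
  -- The supremum extends the passage from height to arc length to heights that no point attains;
  -- values in `EReal` allow for empty and unbounded sets.
  let τ : ℝ≥0∞ → EReal := fun s =>
    sSup ((fun e => (signedCoord c Γ x e : EReal)) '' {e | e ∈ ray c Γ x ∧ height c Γ U e ≤ s})
  have hτ : ∀ y ∈ ray c Γ x, τ (height c Γ U y) = signedCoord c Γ x y := by
    intro y hy
    refine le_antisymm (sSup_le ?_) (le_sSup ⟨y, ⟨hy, le_rfl⟩, rfl⟩)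
    rintro _ ⟨e, ⟨he, hey⟩, rfl⟩
    exact EReal.coe_le_coe_iff.2
      (h.dist_eq_signedCoord_sub he hy (h.of_height_le hU hx he hy hey)).2
  refine ⟨τ, fun s t hst => sSup_le_sSup (image_mono fun e he => ⟨he.1, he.2.trans hst⟩), ?_⟩
  intro y hy z hz hyz
  have hset : {a : ℝ | τ (height c Γ U y) ≤ a ∧ (a : EReal) < τ (height c Γ U z)} =
      Ico (signedCoord c Γ x y) (signedCoord c Γ x z) := by
    ext a
    simp [hτ y hy, hτ z hz]
  rw [arcCost, hset, Real.volume_Ico, (h.dist_eq_signedCoord_sub hy hz hyz).1]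

end Order

section Measurability

variable {X : Type*} [MetricSpace X] [CompleteSpace X] [SecondCountableTopology X]
  [MeasurableSpace X] [BorelSpace X] {c : X → X → ℝ≥0∞} {Γ : Set (X × X)}
  {U : ℕ → Set X}

theorem aemeasurable_height (hc : Measurable (Function.uncurry c)) (hΓ : MeasurableSet Γ)
    (hU : ∀ n, IsOpen (U n)) (μ : Measure X) [IsFiniteMeasure μ] :
    AEMeasurable (height c Γ U) μ := by
  refine AEMeasurable.tsum fun n => aemeasurable_const.indicator₀
    (NullMeasurableSet.compl (AnalyticSet.nullMeasurableSet ?_ μ))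
  have he : before c Γ (U n) =
      Prod.fst '' (Prod.snd ⁻¹' U n ∩ orientedRays c Γ) := by
    ext y
    simp [before]
  rw [he]
  exact (((hU n).preimage continuous_snd).measurableSet.analyticSet.inter
    (analyticSet_orientedRays hc hΓ)).image_of_continuous continuous_fst

theorem aemeasurable_label (hc : Measurable (Function.uncurry c)) (hΓ : MeasurableSet Γ)
    (hU : ∀ n, IsOpen (U n)) (μ : Measure X) [IsFiniteMeasure μ] :
    AEMeasurable (label c Γ U) μ := by
  refine aemeasurable_pi_iff.2 fun n => AEMeasurable.indicator₀ aemeasurable_const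
    (AnalyticSet.nullMeasurableSet ?_ μ)
  have hG := analyticSet_orientedRays hc hΓ
  have he : {y | ∃ z ∈ U n, z ∈ transportSet c Γ ∧ z ∈ ray c Γ y} =
      Prod.fst '' (Prod.snd ⁻¹' U n ∩ (Prod.snd ⁻¹' transportSet c Γ ∩
        (orientedRays c Γ ∪ Prod.swap ⁻¹' orientedRays c Γ))) := by
    ext y
    simp [ray]
  rw [he]
  exact (((hU n).preimage continuous_snd).measurableSet.analyticSet.inter
    (((analyticSet_transportSet hc hΓ).preimage continuous_snd).inter
      (hG.union (hG.preimage continuous_swap)))).image_of_continuous continuous_fst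

end Measurability

end RaySetting

end GeodesicMonge

namespace MeasureTheory

/-- The image is analytic and perhaps not Borel, so its measure is computed through null
measurability. -/
theorem map_compl_image_eq_zero {Z Y : Type*} [MeasurableSpace Z] [StandardBorelSpace Z]
    [TopologicalSpace Y] [PolishSpace Y] [MeasurableSpace Y] [BorelSpace Y] (m : Measure Z)
    [IsFiniteMeasure m] {g : Z → Y} (hg : Measurable g) {s : Set Z} (hs : MeasurableSet s)
    (h : m sᶜ = 0) : m.map g (g '' s)ᶜ = 0 := by
  have hn := ((hs.analyticSet_image hg).nullMeasurableSet (m.map g)).compl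
  rw [Measure.map_apply₀ hg.aemeasurable hn]
  exact measure_mono_null (fun z hz hzs => hz ⟨z, hzs, rfl⟩) h

end MeasureTheory

namespace GeodesicMonge

/-! ### The transport map -/

section Transport

variable {X : Type*} [MetricSpace X] [CompleteSpace X] [SecondCountableTopology X]
  [MeasurableSpace X] [BorelSpace X] {c : X → X → ℝ≥0∞} {Γ : Set (X × X)} {U : ℕ → Set X}

/-- On a measurable subset `D` of the transport set, where the label and the height agree with a
measurable map, the plan can be replaced by a map that is monotone along the rays. -/
theorem RaySetting.exists_map_on (h : RaySetting c Γ)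
    (hU : TopologicalSpace.IsTopologicalBasis (range U)) (hΓ : MeasurableSet Γ) {μ : Measure X}
    [IsFiniteMeasure μ] (hnd : NonDegenerate c Γ μ) {φ : X → (ℕ → ℝ≥0∞) × ℝ≥0∞}
    (hφ : Measurable φ) {D Y : Set X} (hD : MeasurableSet D) (hY : MeasurableSet Y)
    (hDT : D ⊆ transportSet c Γ) (hDY : D ⊆ Y) (hφY : ∀ x ∈ Y, φ x = (label c Γ U x, height c Γ U x))
    (π : Measure (X × X)) [IsFiniteMeasure π] (hfst : π.map Prod.fst = μ.restrict D)
    (hπ : π (Γ ∩ D ×ˢ Y)ᶜ = 0) :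
    ∃ T : X → X, Measurable T ∧ (μ.restrict D).map T = π.map Prod.snd ∧
      ∫⁻ x in D, c x (T x) ∂μ = ∫⁻ p, c p.1 p.2 ∂π ∧
      ∃ N : Set X, μ.restrict D N = 0 ∧ (∀ x ∈ D \ N, (x, T x) ∈ orientedRays c Γ) ∧
        ∀ x ∈ D \ N, ∀ x' ∈ D \ N, (x, x') ∈ orientedRays c Γ →
          (T x, T x') ∈ orientedRays c Γ := by
  have hm := h.dist.measurable
  rcases isEmpty_or_nonempty X with hX | hX
  · refine ⟨id, measurable_id, Subsingleton.elim _ _, ?_, ∅, by simp, ?_, ?_⟩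
    · rw [Subsingleton.elim (μ.restrict D) 0, Subsingleton.elim π 0, lintegral_zero_measure,
        lintegral_zero_measure]
    · exact fun x => hX.elim x
    · exact fun x => hX.elim x
  set R := Γ ∩ D ×ˢ Y with hRdef
  have hR : MeasurableSet R := hΓ.inter (hD.prod hY)
  have hRae : ∀ᵐ p ∂π, p ∈ R := hπ
  have hφD : ∀ x ∈ D, φ x = (label c Γ U x, height c Γ U x) := fun x hx => hφY x (hDY hx)
  have hRG : ∀ p ∈ R, (p.1, p.2) ∈ orientedRays c Γ := fun p hp =>
    subset_orientedRays h.dist.self hp.1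
  have hφ1 : Measurable fun x => (φ x).1 := measurable_fst.comp hφ
  have hφ2 : Measurable fun x => (φ x).2 := measurable_snd.comp hφ
  -- equal labels mean equal rays
  have hlab : ∀ x ∈ D, ∀ x' ∈ D, (φ x).1 = (φ x').1 → ray c Γ x' = ray c Γ x := by
    intro x hx x' hx' he
    rw [hφD x hx, hφD x' hx'] at he
    exact h.ray_eq (hDT hx) (hDT hx') (h.mem_ray_of_label_eq hU (hDT hx) (hDT hx') he.symm)
  have hself : ∀ x ∈ D, x ∈ ray c Γ x := fun x hx => h.self_mem_ray (hDT hx)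
  -- the points are measurable functions of their coordinates
  set Ψ : X × X → (ℕ → ℝ≥0∞) × ℝ≥0∞ := fun p => ((φ p.1).1, (φ p.2).2) with hΨdef
  have hΨ : Measurable Ψ := (hφ1.comp measurable_fst).prodMk (hφ2.comp measurable_snd)
  obtain ⟨ρ₁, hρ₁, hρ₁e⟩ := exists_measurable_comp_eq_on hφ measurable_id hD (by
    intro x hx x' hx' he
    have hray := hlab x hx x' hx' (congrArg Prod.fst he)
    have h2 := congrArg Prod.snd he
    rw [hφD x hx, hφD x' hx'] at h2
    exact h.eq_of_height_eq hU (hDT hx) (hself x hx) (hray ▸ hself x' hx') h2)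
  -- A final point may be an end point, possibly common to several rays, so its ray is read from the
  -- label of the initial point.
  obtain ⟨ρ₂, hρ₂, hρ₂e⟩ := exists_measurable_comp_eq_on hΨ measurable_snd hR (by
    intro p hp p' hp' he
    have hray := hlab p.1 hp.2.1 p'.1 hp'.2.1 (Prod.ext_iff.1 he).1
    have h2 : (φ p.2).2 = (φ p'.2).2 := (Prod.ext_iff.1 he).2
    rw [hφY p.2 hp.2.2, hφY p'.2 hp'.2.2] at h2
    exact h.eq_of_height_eq hU (hDT hp.2.1) (Or.inl (hRG p hp))
      (hray ▸ Or.inl (hRG p' hp')) h2)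
  -- the plan in coordinates
  set κ : X × X → (ℕ → ℝ≥0∞) × (ℝ≥0∞ × ℝ≥0∞) := fun p => ((φ p.1).1, ((φ p.1).2, (φ p.2).2))
  have hκ : Measurable κ := (hφ1.comp measurable_fst).prodMk
    ((hφ2.comp measurable_fst).prodMk (hφ2.comp measurable_snd))
  have hα : (π.map κ).map (Prod.map id Prod.fst) = (μ.restrict D).map φ := by
    rw [Measure.map_map (measurable_id.prodMap measurable_fst) hκ, ← hfst,
      Measure.map_map hφ measurable_fst]
    rfl
  have hβ : (π.map κ).map (Prod.map id Prod.snd) = π.map Ψ := by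
    rw [Measure.map_map (measurable_id.prodMap measurable_snd) hκ]
    rfl
  have hord : ∀ᵐ q ∂π.map κ, q.2.1 ≤ q.2.2 := by
    refine (ae_map_iff hκ.aemeasurable (measurableSet_le (measurable_fst.comp measurable_snd)
      (measurable_snd.comp measurable_snd))).2 ?_
    filter_upwards [hRae] with p hp
    simp only [κ, hφD p.1 hp.2.1, hφY p.2 hp.2.2]
    exact h.height_le U (hRG p hp)
  obtain ⟨S, hS, hSmono, hSmap, hSge, hScost⟩ := exists_fiber_rearrangement (π.map κ) hord (by
    intro B hB hsec
    rw [hα, Measure.map_apply hφ hB, Measure.restrict_apply (hφ hB)]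
    -- Comparable points of `D` share their label; on a partial section they then share their
    -- height, hence coincide.
    refine h.measure_antichain hΓ hnd ((hφ hB).inter hD).nullMeasurableSet
      (fun x hx => Or.inl (hDT hx.2).1) ?_
    rintro x ⟨hxB, hxD⟩ x' ⟨hxB', hxD'⟩ hxx'
    have hl : (φ x').1 = (φ x).1 := by
      rw [hφD x hxD, hφD x' hxD']
      exact h.label_eq U (hDT hxD) (hDT hxD') (Or.inl hxx')
    have hs : (φ x).2 = (φ x').2 := by
      refine hsec (φ x).1 _ _ hxB ?_
      rw [← hl]
      exact hxB'
    rw [hφD x hxD, hφD x' hxD'] at hs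
    exact h.eq_of_height_eq hU (hDT hxD) (hself x hxD) (Or.inl hxx') hs)
  rw [hα] at hSmap hSge hScost
  rw [hβ] at hSmap hScost
  have hFnull : π.map Ψ (Ψ '' R)ᶜ = 0 := map_compl_image_eq_zero π hΨ hR hπ
  have hEnull : (μ.restrict D).map φ (φ '' D)ᶜ = 0 :=
    map_compl_image_eq_zero _ hφ hD (by simp [Measure.restrict_apply hD.compl])
  have hSφ : Measurable fun p : (ℕ → ℝ≥0∞) × ℝ≥0∞ => (p.1, S p) := measurable_fst.prodMk hS
  set T : X → X := fun x => ρ₂ ((φ x).1, S (φ x)) with hTdef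
  have hT : Measurable T := hρ₂.comp (hSφ.comp hφ)
  have hgood1 : ∀ᵐ x ∂μ.restrict D, (φ x).2 ≤ S (φ x) := ae_of_ae_map hφ.aemeasurable hSge
  have hgood2 : ∀ᵐ x ∂μ.restrict D, ((φ x).1, S (φ x)) ∈ Ψ '' R := by
    have h1 : ∀ᵐ q ∂((μ.restrict D).map φ).map (fun p => (p.1, S p)), q ∈ Ψ '' R := by
      rw [hSmap]
      exact hFnull
    exact ae_of_ae_map hφ.aemeasurable (ae_of_ae_map hSφ.aemeasurable h1)
  -- the image of a good point
  have hTray : ∀ x ∈ D, ((φ x).1, S (φ x)) ∈ Ψ '' R →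
      T x ∈ ray c Γ x ∧ height c Γ U (T x) = S (φ x) := by
    rintro x hx ⟨p, hp, hpe⟩
    have hTx : T x = p.2 := by rw [hTdef]; simp only; rw [← hpe, hρ₂e p hp]
    have hray := hlab x hx p.1 hp.2.1 (congrArg Prod.fst hpe).symm
    have h2 : (φ p.2).2 = S (φ x) := congrArg Prod.snd hpe
    rw [hφY p.2 hp.2.2] at h2
    rw [hTx]
    exact ⟨hray ▸ Or.inl (hRG p hp), h2⟩
  refine ⟨T, hT, ?_, ?_, {x | ¬ ((φ x).2 ≤ S (φ x) ∧ ((φ x).1, S (φ x)) ∈ Ψ '' R)}, ?_, ?_, ?_⟩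
  · have h1 : (μ.restrict D).map T =
        (((μ.restrict D).map φ).map (fun p => (p.1, S p))).map ρ₂ := by
      rw [Measure.map_map hρ₂ hSφ, Measure.map_map (hρ₂.comp hSφ) hφ]
      rfl
    rw [h1, hSmap, Measure.map_map hρ₂ hΨ]
    exact Measure.map_congr (hRae.mono fun p hp => hρ₂e p hp)
  · set C : (ℕ → ℝ≥0∞) × (ℝ≥0∞ × ℝ≥0∞) → ℝ≥0∞ := fun q =>
      c (ρ₁ (q.1, q.2.1)) (ρ₂ (q.1, q.2.2)) with hCdef
    have hC : Measurable C := hm.comp ((hρ₁.comp (measurable_fst.prodMk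
      (measurable_fst.comp measurable_snd))).prodMk (hρ₂.comp (measurable_fst.prodMk
      (measurable_snd.comp measurable_snd))))
    have hcost := hScost C hC (φ '' D) (Ψ '' R) hEnull hFnull (by
      intro l
      by_cases hl : ∃ x₀ ∈ D, (φ x₀).1 = l
      · obtain ⟨x₀, hx₀, rfl⟩ := hl
        obtain ⟨τ, hτ, hτc⟩ := h.exists_arcCost_eq hU (hDT hx₀)
        refine ⟨τ, hτ, ?_⟩
        rintro s t ⟨x, hx, hxe⟩ ⟨p, hp, hpe⟩ hst
        have hC' : C ((φ x₀).1, (s, t)) = c x p.2 := by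
          rw [hCdef]
          simp only
          rw [← hxe, ← hpe, hρ₁e x hx, hρ₂e p hp]
          rfl
        have hrx := hlab x₀ hx₀ x hx (congrArg Prod.fst hxe).symm
        have hrp := hlab x₀ hx₀ p.1 hp.2.1 (congrArg Prod.fst hpe).symm
        have hx' : x ∈ ray c Γ x₀ := hrx ▸ hself x hx
        have hp' : p.2 ∈ ray c Γ x₀ := hrp ▸ Or.inl (hRG p hp)
        have hs : height c Γ U x = s := by
          have := congrArg Prod.snd hxe
          rwa [hφD x hx] at this
        have ht : height c Γ U p.2 = t := by
          have : (φ p.2).2 = t := congrArg Prod.snd hpe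
          rwa [hφY p.2 hp.2.2] at this
        rw [hC', ← hs, ← ht]
        rw [← hs, ← ht] at hst
        exact hτc x hx' p.2 hp' (h.of_height_le hU (hDT hx₀) hx' hp' hst)
      -- No point of `D` has the label `l`, so the requirement is void.
      · refine ⟨fun _ => ⊥, monotone_const, ?_⟩
        rintro s t ⟨x, hx, hxe⟩
        exact absurd ⟨x, hx, congrArg Prod.fst hxe⟩ hl)
    have hCS : Measurable fun p : (ℕ → ℝ≥0∞) × ℝ≥0∞ => C (p.1, (p.2, S p)) :=
      hC.comp (measurable_fst.prodMk (measurable_snd.prodMk hS))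
    rw [lintegral_map hC hκ, lintegral_map hCS hφ] at hcost
    have e1 : ∫⁻ p, C (κ p) ∂π = ∫⁻ p, c p.1 p.2 ∂π := by
      refine lintegral_congr_ae (hRae.mono fun p hp => ?_)
      change c (ρ₁ (φ p.1)) (ρ₂ (Ψ p)) = c p.1 p.2
      rw [hρ₁e p.1 hp.2.1, hρ₂e p hp]
      rfl
    rw [← e1, hcost]
    refine setLIntegral_congr_fun hD fun x hx => ?_
    change c x (T x) = c (ρ₁ (φ x)) (T x)
    rw [hρ₁e x hx]
    rfl
  · exact hgood1.and hgood2
  · rintro x ⟨hx, hxN⟩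
    obtain ⟨h1, h2⟩ := not_not.1 hxN
    obtain ⟨h3, h4⟩ := hTray x hx h2
    refine h.of_height_le hU (hDT hx) (hself x hx) h3 ?_
    rw [h4]
    rwa [hφD x hx] at h1 ⊢
  · rintro x ⟨hx, hxN⟩ x' ⟨hx', hxN'⟩ hxx'
    obtain ⟨-, h2⟩ := not_not.1 hxN
    obtain ⟨-, h2'⟩ := not_not.1 hxN'
    obtain ⟨h3, h4⟩ := hTray x hx h2
    obtain ⟨h3', h4'⟩ := hTray x' hx' h2'
    rw [h.ray_eq (hDT hx) (hDT hx') (Or.inl hxx')] at h3'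
    refine h.of_height_le hU (hDT hx) h3 h3' ?_
    rw [h4, h4', hφD x hx, hφD x' hx', h.label_eq U (hDT hx) (hDT hx') (Or.inl hxx')]
    exact hSmono _ (h.height_le U hxx')

end Transport

end GeodesicMonge

/-! ### Assembly of the map on and off the transport set. -/

theorem theoremT {X : Type*} [MetricSpace X] [CompleteSpace X] [SecondCountableTopology X]
    [MeasurableSpace X] [BorelSpace X]
    (dL : X → X → ℝ≥0∞) (hdL : GeodesicMonge.IsNonbranchingGeodesicDist dL)
    (μ ν : Measure X) [IsProbabilityMeasure μ] [IsProbabilityMeasure ν]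
    (π : Measure (X × X)) (hπ : GeodesicMonge.IsTransferencePlan μ ν π)
    (hcost : ∫⁻ p, dL p.1 p.2 ∂π ≠ ∞)
    (Γ : Set (X × X)) (hΓ : MeasurableSet Γ) (hΓfin : ∀ p ∈ Γ, dL p.1 p.2 ≠ ∞)
    (hΓmono : GeodesicMonge.CyclicallyMonotone dL Γ) (hπΓ : π Γᶜ = 0)
    (hnd : GeodesicMonge.NonDegenerate dL Γ μ) :
    ∃ T : X → X, Measurable T ∧ μ.map T = ν ∧
      ∫⁻ x, dL x (T x) ∂μ = ∫⁻ p, dL p.1 p.2 ∂π ∧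
      ∃ N : Set X, μ N = 0 ∧
        (∀ x ∉ N, T x = x ∨ (x, T x) ∈ GeodesicMonge.orientedRays dL Γ) ∧
        (∀ x ∉ N, ∀ x' ∉ N, (x, x') ∈ GeodesicMonge.orientedRays dL Γ →
          (T x, T x') ∈ GeodesicMonge.orientedRays dL Γ) := by
  classical
  obtain ⟨hprob, hfst, hsnd⟩ := hπ
  have h : GeodesicMonge.RaySetting dL Γ := ⟨hdL, hΓfin, hΓmono⟩
  have hm := hdL.measurable
  have hne : Nonempty X := nonempty_of_isProbabilityMeasure μ
  obtain ⟨B, hBc, -, hB⟩ := TopologicalSpace.exists_countable_basis X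
  have hBne : B.Nonempty := by
    obtain ⟨V, hV, -⟩ := hB.exists_subset_of_mem_open (mem_univ hne.some) isOpen_univ
    exact ⟨V, hV⟩
  obtain ⟨U, rfl⟩ := hBc.exists_eq_range hBne
  have hUo : ∀ n, IsOpen (U n) := fun n => hB.isOpen (mem_range_self n)
  -- a measurable version of the label and the height
  have hf : AEMeasurable (fun x => (GeodesicMonge.label dL Γ U x, GeodesicMonge.height dL Γ U x))
      (μ + ν) :=
    (GeodesicMonge.RaySetting.aemeasurable_label hm hΓ hUo _).prodMk
      (GeodesicMonge.RaySetting.aemeasurable_height hm hΓ hUo _)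
  obtain ⟨φ, hφ, hφe⟩ := hf
  -- The exceptional set is null for both `μ` and `ν`, so `φ` gives the true coordinates at both
  -- points of almost every pair.
  obtain ⟨Y', hY', hYm', hY0⟩ := exists_measurable_superset_of_null (ae_iff.1 hφe)
  obtain ⟨hYμ, hYν⟩ : μ Y' = 0 ∧ ν Y' = 0 := by simpa using hY0
  have hφY : ∀ x ∈ Y'ᶜ, φ x = (GeodesicMonge.label dL Γ U x, GeodesicMonge.height dL Γ U x) :=
    fun x hx => by
      by_contra hne
      exact hx (hY' (Ne.symm hne))
  obtain ⟨D', hDT', hDm', hDe⟩ := ((GeodesicMonge.analyticSet_transportSet hm hΓ).nullMeasurableSet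
    μ).exists_measurable_subset_ae_eq
  set D := D' \ Y'
  have hDm : MeasurableSet D := hDm'.diff hYm'
  have hDT : D ⊆ GeodesicMonge.transportSet dL Γ := sdiff_subset.trans hDT'
  have hTE : GeodesicMonge.transportSet dL Γ ⊆ GeodesicMonge.transportSetE dL Γ :=
    fun x hx => Or.inl hx.1
  have hrest : μ (GeodesicMonge.transportSetE dL Γ \ D) = 0 := by
    refine measure_mono_null ?_ (measure_union_null (h.measure_end_points hΓ hnd)
      (measure_union_null (ae_le_set.1 hDe.symm.le) hYμ))
    rintro x ⟨hx, hxD⟩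
    by_cases hxT : x ∈ GeodesicMonge.transportSet dL Γ
    · by_cases hxD' : x ∈ D'
      · exact Or.inr (Or.inr (by_contra fun hxY => hxD ⟨hxD', hxY⟩))
      · exact Or.inr (Or.inl ⟨hxT, hxD'⟩)
    · exact Or.inl ⟨hx, hxT⟩
  have hpre : MeasurableSet (Prod.fst ⁻¹' D : Set (X × X)) := measurable_fst hDm
  have hfstD : (π.restrict (Prod.fst ⁻¹' D)).map Prod.fst = μ.restrict D := by
    rw [← Measure.restrict_map measurable_fst hDm, hfst]
  have hπD : π.restrict (Prod.fst ⁻¹' D) (Γ ∩ D ×ˢ Y'ᶜ)ᶜ = 0 := by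
    rw [Measure.restrict_apply (hΓ.inter (hDm.prod hYm'.compl)).compl]
    have hνY : π (Prod.snd ⁻¹' Y') = 0 := by
      rw [← Measure.map_apply measurable_snd hYm', hsnd, hYν]
    refine measure_mono_null ?_ (measure_union_null hπΓ hνY)
    rintro ⟨x, y⟩ ⟨hxy, hxD⟩
    by_cases hxyΓ : (x, y) ∈ Γ
    · exact Or.inr (by_contra fun hy => hxy ⟨hxyΓ, hxD, hy⟩)
    · exact Or.inl hxyΓ
  obtain ⟨T, hT, hTmap, hTcost, N, hN, hN1, hN2⟩ := h.exists_map_on hB hΓ hnd hφ hDm hYm'.compl hDT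
    (fun x hx => hx.2) hφY (π.restrict (Prod.fst ⁻¹' D)) hfstD hπD
  -- outside the transport set the plan is the identity
  have hdiag : ∀ᵐ p ∂π.restrict (Prod.fst ⁻¹' D)ᶜ, p.2 = p.1 := by
    rw [ae_restrict_iff' hpre.compl]
    have h1 : ∀ᵐ p ∂π, p ∈ Γ := hπΓ
    have h2 : ∀ᵐ p ∂π, p.1 ∉ GeodesicMonge.transportSetE dL Γ \ D := by
      have : ∀ᵐ x ∂π.map Prod.fst, x ∉ GeodesicMonge.transportSetE dL Γ \ D := by
        rw [hfst]
        exact measure_eq_zero_iff_ae_notMem.1 hrest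
      exact ae_of_ae_map measurable_fst.aemeasurable this
    filter_upwards [h1, h2] with p hp1 hp2 hp3
    by_contra hne
    -- A pair of `Γ` with distinct points puts the first one in `transportSetE`, which is negligible
    -- outside `D`.
    exact hp2 ⟨Or.inr ⟨p.2, hne, GeodesicMonge.subset_orientedRays hdL.self hp1⟩, hp3⟩
  have hid : μ.restrict Dᶜ = (π.restrict (Prod.fst ⁻¹' D)ᶜ).map Prod.snd := by
    rw [← hfst, Measure.restrict_map measurable_fst hDm.compl]
    exact Measure.map_congr (hdiag.mono fun p hp => hp.symm)
  set T' : X → X := D.piecewise T id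
  have hT' : Measurable T' := hT.piecewise hDm measurable_id
  have hT'D : ∀ x ∈ D, T' x = T x := fun x hx => piecewise_eq_of_mem D T id hx
  have hT'c : ∀ x ∉ D, T' x = x := fun x hx => piecewise_eq_of_notMem D T id hx
  have hcT : Measurable fun x => dL x (T' x) := hm.comp (measurable_id.prodMk hT')
  refine ⟨T', hT', ?_, ?_, (GeodesicMonge.transportSetE dL Γ \ D) ∪ (N ∩ D), ?_, ?_, ?_⟩
  · rw [← Measure.restrict_add_restrict_compl (μ := μ) hDm, Measure.map_add _ _ hT',
      Measure.map_congr (ae_restrict_of_forall_mem hDm hT'D), hTmap,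
      Measure.map_congr (ae_restrict_of_forall_mem hDm.compl hT'c), Measure.map_id', hid,
      ← Measure.map_add _ _ measurable_snd, Measure.restrict_add_restrict_compl hpre, hsnd]
  · rw [← lintegral_add_compl _ hDm, ← lintegral_add_compl (μ := π) _ hpre,
      setLIntegral_congr_fun hDm fun x hx => by rw [hT'D x hx], hTcost,
      setLIntegral_congr_fun hDm.compl fun x hx => by rw [hT'c x hx, hdL.self]]
    congr 1
    rw [lintegral_zero]
    refine ((lintegral_congr_ae (g := fun _ => 0) ?_).trans lintegral_zero).symm
    filter_upwards [hdiag] with p hp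
    rw [hp, hdL.self]
  · refine measure_union_null hrest ?_
    rwa [← Measure.restrict_apply' hDm]
  · intro x hx
    by_cases hxD : x ∈ D
    · rw [hT'D x hxD]
      exact Or.inr (hN1 x ⟨hxD, fun hxN => hx (Or.inr ⟨hxN, hxD⟩)⟩)
    · exact Or.inl (hT'c x hxD)
  · have hout : ∀ x ∉ (GeodesicMonge.transportSetE dL Γ \ D) ∪ (N ∩ D), x ∉ D →
        x ∉ GeodesicMonge.transportSetE dL Γ := fun x hx hxD hxE => hx (Or.inl ⟨hxE, hxD⟩)
    intro x hx x' hx' hxx'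
    by_cases hxD : x ∈ D
    · by_cases hxD' : x' ∈ D
      · rw [hT'D x hxD, hT'D x' hxD']
        exact hN2 x ⟨hxD, fun hxN => hx (Or.inr ⟨hxN, hxD⟩)⟩ x'
          ⟨hxD', fun hxN => hx' (Or.inr ⟨hxN, hxD'⟩)⟩ hxx'
      -- A point outside `D` and the exceptional set is not in `transportSetE`, so it is comparable
      -- with no other point.
      · refine absurd (Or.inl ⟨x, ?_, hxx'⟩) (hout x' hx' hxD')
        rintro rfl
        exact hxD' hxD
    · have hxE := hout x hx hxD
      have he : x = x' := by
        by_contra hne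
        exact hxE (Or.inr ⟨x', Ne.symm hne, hxx'⟩)
      subst he
      rwa [hT'c x hxD]
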